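/- All graphs are finite and simple, and $\alpha(G)$ denotes the independence number of $G$. For integers $t,m$ let $R(t,m)$ be the least $n$ such that every graph on $n$ vertices contains a clique $K_t$ or an independent set of size $m$. For $t\ge 2$ let $Q(t,n)$ be the minimum of $\alpha(G)$ over all $K_t$-free graphs $G$ on $n$ vertices. For a graph $H$ and a real number $x$ let $\mathrm{RT}(n,H,x)$ be the maximum number of edges of an $H$-free graph on $n$ vertices with independence number less than $x$ (and $0$ if no such graph exists). For a function $f:\mathbb N\to\mathbb R$ put $$\overline{\mathrm{RT}}(H,f)=\limsup_{n\to\infty}\frac{\mathrm{RT}(n,H,f(n))}{n^2},\qquad \underline{\mathrm{RT}}(H,f)=\liminf_{n\to\infty}\frac{\mathrm{RT}(n,H,f(n))}{n^2}.$$ For functions $f,g$ with $g(n)\le f(n)$ for all sufficiently large $n$, we say that $H$ has a *phase transition from $f$ to $g$* if $\overline{\mathrm{RT}}(H,g)<\underline{\mathrm{RT}}(H,f)$. We say that $H$ has a *strong phase transition at $f$* if $H$ has a phase transition from $f$ to $\varphi f$ for every function $\varphi:\mathbb N\to\mathbb R$ with $\varphi(n)\to 0$ as $n\to\infty$. For an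 integer $\ell\ge 2$ let $\mathrm{C}(\ell)$ be the assertion that there exist $\vartheta>0$ and $N>0$ such that for all $n>N$ $$R(\ell-1,n)\le \frac{R(\ell,n)}{n^{\vartheta}}.$$ (It is conjectured that $\mathrm{C}(\ell)$ holds for every $\ell\ge 3$; $\mathrm{C}(2)$ holds trivially, since $R(1,n)=1$ and $R(2,n)=n$ for $n\ge1$.) **Theorem.** Let $t\ge 2$ and $s\ge 0$ be integers and assume that $\mathrm{C}(t)$ and $\mathrm{C}(t+1)$ hold. If $K_s$ has a phase transition from $Q(t,n)$ to $Q(t+1,n)$, then $K_s$ has a strong phase transition at $Q(t,n)$. -/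

import Mathlib

open Filter Topology

namespace RamseyTuran

/-- The Ramsey number `R(t, m)`: the least `n` such that every graph on `n` vertices contains
a clique on `t` vertices or an independent set of `m` vertices. -/
noncomputable def ramseyNumber (t m : ℕ) : ℕ :=
  sInf {n : ℕ | ∀ G : SimpleGraph (Fin n), ¬ G.CliqueFree t ∨ ¬ G.IndepSetFree m}

/-- The inverse Ramsey function `Q(t, n)`: the minimum independence number of the `K_t`-free
graphs on `n` vertices (such graphs exist for all `n` when `2 ≤ t`). -/
noncomputable def Q (t n : ℕ) : ℕ :=
  sInf {a : ℕ | ∃ G : SimpleGraph (Fin n), G.CliqueFree t ∧ G.indepNum = a}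

/-- The Ramsey–Turán function `RT(n, H, x)`: the maximum number of edges of an `H`-free graph on
`n` vertices with independence number less than `x`; it is `0` if there is no such graph. -/
noncomputable def RT {W : Type*} (n : ℕ) (H : SimpleGraph W) (x : ℝ) : ℕ :=
  sSup {e : ℕ | ∃ G : SimpleGraph (Fin n),
    H.Free G ∧ (G.indepNum : ℝ) < x ∧ G.edgeSet.ncard = e}

/-- The upper Ramsey–Turán density of `H` with respect to `f`. -/
noncomputable def upperDensity {W : Type*} (H : SimpleGraph W) (f : ℕ → ℝ) : ℝ :=
  limsup (fun n : ℕ => (RT n H (f n) : ℝ) / (n : ℝ) ^ 2) atTop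

/-- The lower Ramsey–Turán density of `H` with respect to `f`. -/
noncomputable def lowerDensity {W : Type*} (H : SimpleGraph W) (f : ℕ → ℝ) : ℝ :=
  liminf (fun n : ℕ => (RT n H (f n) : ℝ) / (n : ℝ) ^ 2) atTop

/-- `H` has a phase transition from `f` to `g`, where `g n ≤ f n` for all large `n`. -/
def HasPhaseTransition {W : Type*} (H : SimpleGraph W) (f g : ℕ → ℝ) : Prop :=
  (∀ᶠ n in atTop, g n ≤ f n) ∧ upperDensity H g < lowerDensity H f

/-- `H` has a strong phase transition at `f`: for every `φ` tending to `0`, it has a phase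
transition from `f` to `φ f`. -/
def HasStrongPhaseTransition {W : Type*} (H : SimpleGraph W) (f : ℕ → ℝ) : Prop :=
  ∀ φ : ℕ → ℝ, Tendsto φ atTop (𝓝 0) → HasPhaseTransition H f (fun n => φ n * f n)

/-- The polynomial-gap conjecture for Ramsey numbers at the integer `ℓ`:
`R(ℓ - 1, n) ≤ R(ℓ, n) / n ^ ϑ` for some `ϑ > 0` and all large `n`. -/
def RamseyGapConjecture (ℓ : ℕ) : Prop :=
  ∃ ϑ : ℝ, 0 < ϑ ∧ ∃ N : ℕ, 0 < N ∧ ∀ n : ℕ, N < n →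
    (ramseyNumber (ℓ - 1) n : ℝ) ≤ (ramseyNumber ℓ n : ℝ) / (n : ℝ) ^ ϑ

end RamseyTuran

/-!
Let `k (t - 1) < s ≤ (k + 1) (t - 1)`. A join of `k` balanced copies of an extremal `K_t`-free graph
shows that the lower density of `K_s` at `Q t` is at least `(1 - 1 / k) / 2`: the gap conjecture
makes `Q t (n / k + 1)` smaller than `Q t n`. The phase transition forces `k ≥ 2`, and `s ≤ k t`
since otherwise the same construction with `K_{t + 1}`-free graphs gives this density at
`Q (t + 1)`, while the upper density at `Q t` does not exceed it.

Conversely, let `G` be `K_s`-free with independence number below `φ Q_t`, where `φ → 0`. By the gap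
conjecture every `n ^ (1 - ε)` vertices of `G` contain a `K_{t - 1}`, and since `Q t` is subadditive
under splitting the vertex set, every linear number of vertices contains a `K_t`. If `G` had density
close to `1 - 1 / k`, then some subgraph on `N` vertices would have minimum degree close to
`(1 - 1 / k) N`. If it contains `N ^ (k + 1 - δ)` cliques of size `k + 1`, iterated dependent random
choice blows their `k + 1` vertices up to copies of `K_{t - 1}`, giving a `K_{(k + 1) (t - 1)}`.
Otherwise averaging yields a `k`-clique such that the common neighbourhoods of all but one of its
vertices have about `N / k` vertices each, few internal edges, and are nearly disjoint. The minimum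
degree then forces these `k` sets to be almost completely joined, and picking a `K_t` in each of
them greedily gives a `K_{k t}`. Both contradict `K_s`-freeness.
-/

namespace RamseyTuran

open Finset

section Ramsey

variable {V W : Type*}

/-- Every graph on `n` vertices has a clique on `t` vertices or an independent set of `m` vertices;
`ramseyNumber t m` is the least such `n`. -/
def IsRamsey (t m n : ℕ) : Prop :=
  ∀ G : SimpleGraph (Fin n), ¬ G.CliqueFree t ∨ ¬ G.IndepSetFree m

theorem cliqueFree_comap_of_cliqueFreeOn {G : SimpleGraph W} {s : Set W} {t : ℕ}
    (hG : G.CliqueFreeOn s t) {e : V ↪ W} (he : ∀ x, e x ∈ s) : (G.comap e).CliqueFree t :=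
  fun C hC => hG (t := C.map e) (by simpa [Set.subset_def] using fun x _ => he x)
    (hC.map.mono (SimpleGraph.map_comap_le e G))

theorem compl_comap (G : SimpleGraph W) (e : V ↪ W) : (G.comap e)ᶜ = Gᶜ.comap e := by
  ext x y
  simp

theorem IsRamsey.not_cliqueFreeOn_or {t m n : ℕ} (h : IsRamsey t m n) (G : SimpleGraph V)
    {U : Finset V} (hU : n ≤ U.card) : ¬ G.CliqueFreeOn U t ∨ ¬ Gᶜ.CliqueFreeOn U m := by
  obtain ⟨e⟩ : Nonempty (Fin n ↪ U) := Function.Embedding.nonempty_of_card_le (by simpa)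
  let f : Fin n ↪ V := e.trans (.subtype _)
  have hf : ∀ i, f i ∈ (U : Set V) := fun i => (e i).2
  refine (h (G.comap f)).imp (mt (cliqueFree_comap_of_cliqueFreeOn · hf)) ?_
  rw [← SimpleGraph.cliqueFree_compl, compl_comap]
  exact mt (cliqueFree_comap_of_cliqueFreeOn · hf)

theorem IsRamsey.pos {t m n : ℕ} (h : IsRamsey t m n) (ht : 0 < t) (hm : 0 < m) : 0 < n := by
  by_contra! hn
  have := h.not_cliqueFreeOn_or (⊥ : SimpleGraph ℕ) (U := ∅) (by simpa using hn)
  simp [ht.ne', hm.ne'] at this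

theorem IsRamsey.add {t m a b : ℕ} (ha : IsRamsey t (m + 1) a) (hb : IsRamsey (t + 1) m b)
    (hab : 0 < a + b) : IsRamsey (t + 1) (m + 1) (a + b) := by
  classical
  intro G
  by_contra! ⟨hclique, hindep⟩
  rw [← SimpleGraph.cliqueFree_compl] at hindep
  let v : Fin (a + b) := ⟨0, hab⟩
  have hdeg : Gᶜ.degree v = a + b - 1 - G.degree v := by simpa using G.degree_compl v
  have hN : G.CliqueFreeOn (G.neighborFinset v) t := by
    simpa using (hclique.cliqueFreeOn (s := Set.univ)).of_succ _ (Set.mem_univ v)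
  have hN' : Gᶜ.CliqueFreeOn (Gᶜ.neighborFinset v) m := by
    simpa using (hindep.cliqueFreeOn (s := Set.univ)).of_succ _ (Set.mem_univ v)
  rcases le_or_gt a (G.degree v) with h | h
  · exact (ha.not_cliqueFreeOn_or G h).elim (· hN) (· hindep.cliqueFreeOn)
  · exact (hb.not_cliqueFreeOn_or G (show b ≤ Gᶜ.degree v by omega)).elim
      (· hclique.cliqueFreeOn) (· hN')

theorem exists_isRamsey_le_pow (t m : ℕ) : ∃ n ≤ m ^ t, IsRamsey t m n := by
  induction t generalizing m with
  | zero => exact ⟨0, by simp, fun G => Or.inl SimpleGraph.not_cliqueFree_zero⟩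
  | succ t iht =>
    induction m with
    | zero => exact ⟨0, by simp, fun G => Or.inr (by simp [← SimpleGraph.cliqueFree_compl])⟩
    | succ m ihm =>
      rcases t.eq_zero_or_pos with rfl | ht
      · refine ⟨1, by simp, fun G => Or.inl ?_⟩
        simp [SimpleGraph.cliqueFree_one]
      obtain ⟨a, ha, ha'⟩ := iht (m + 1)
      obtain ⟨b, hb, hb'⟩ := ihm
      refine ⟨a + b, ?_, ha'.add hb' (Nat.add_pos_left (ha'.pos ht m.succ_pos) b)⟩
      calc a + b ≤ (m + 1) ^ t + m ^ t * m := by rw [← pow_succ]; omega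
        _ ≤ (m + 1) ^ t + (m + 1) ^ t * m := by gcongr; omega
        _ = (m + 1) ^ (t + 1) := by ring

theorem isRamsey_ramseyNumber (t m : ℕ) : IsRamsey t m (ramseyNumber t m) := by
  obtain ⟨n, -, h⟩ := exists_isRamsey_le_pow t m
  exact Nat.sInf_mem (s := {n : ℕ | IsRamsey t m n}) ⟨n, h⟩

theorem IsRamsey.ramseyNumber_le {t m n : ℕ} (h : IsRamsey t m n) : ramseyNumber t m ≤ n :=
  Nat.sInf_le h

theorem ramseyNumber_le_pow (t m : ℕ) : ramseyNumber t m ≤ m ^ t := by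
  obtain ⟨n, hn, h⟩ := exists_isRamsey_le_pow t m
  exact h.ramseyNumber_le.trans hn

theorem ramseyNumber_succ_le {t : ℕ} (ht : 0 < t) (m : ℕ) :
    ramseyNumber (t + 1) (m + 1) ≤ ramseyNumber t (m + 1) + ramseyNumber (t + 1) m :=
  have h := isRamsey_ramseyNumber t (m + 1)
  (h.add (isRamsey_ramseyNumber (t + 1) m)
    (Nat.add_pos_left (h.pos ht m.succ_pos) _)).ramseyNumber_le

theorem not_cliqueFreeOn_of_indepNum_lt [Finite V] {G : SimpleGraph V} {t m : ℕ}
    (hG : G.indepNum < m) {U : Finset V} (hU : ramseyNumber t m ≤ U.card) :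
    ¬ G.CliqueFreeOn U t := by
  refine ((isRamsey_ramseyNumber t m).not_cliqueFreeOn_or G hU).resolve_right (not_not.2 ?_)
  intro C _ hC
  rw [SimpleGraph.isNClique_compl] at hC
  exact hG.not_ge (hC.card_eq ▸ hC.isIndepSet.card_le_indepNum)

theorem indepNum_comap_le [Finite V] [Finite W] (G : SimpleGraph W) (e : V ↪ W) :
    (G.comap e).indepNum ≤ G.indepNum := by
  simp only [← SimpleGraph.cliqueNum_compl, compl_comap]
  obtain ⟨C, hC⟩ := (Gᶜ.comap e).exists_isNClique_cliqueNum
  have hC' := hC.map.mono (SimpleGraph.map_comap_le e Gᶜ)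
  exact hC'.card_eq ▸ hC'.isClique.card_le_cliqueNum

theorem cliqueFree_sum {G : SimpleGraph V} {H : SimpleGraph W} {t : ℕ} (hG : G.CliqueFree t)
    (hH : H.CliqueFree t) : (G ⊕g H).CliqueFree t := by
  intro C hC
  have hleft : G.IsClique C.toLeft := fun x hx y hy hxy => by
    simpa using hC.isClique (by simpa using hx) (by simpa using hy) (Sum.inl_injective.ne hxy)
  have hright : H.IsClique C.toRight := fun x hx y hy hxy => by
    simpa using hC.isClique (by simpa using hx) (by simpa using hy) (Sum.inr_injective.ne hxy)
  have hcard := C.card_toLeft_add_card_toRight.trans hC.card_eq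
  rcases C.toLeft.eq_empty_or_nonempty with h | ⟨x, hx⟩
  · exact hH _ ⟨hright, by simpa [h] using hcard⟩
  rcases C.toRight.eq_empty_or_nonempty with h | ⟨y, hy⟩
  · exact hG _ ⟨hleft, by simpa [h] using hcard⟩
  · simpa using hC.isClique (Finset.mem_toLeft.1 hx) (Finset.mem_toRight.1 hy) (by simp)

theorem indepNum_sum_le [Finite V] [Finite W] (G : SimpleGraph V) (H : SimpleGraph W) :
    (G ⊕g H).indepNum ≤ G.indepNum + H.indepNum := by
  obtain ⟨I, hI⟩ := (G ⊕g H).exists_isNIndepSet_indepNum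
  rw [← hI.card_eq, ← I.card_toLeft_add_card_toRight]
  refine add_le_add (SimpleGraph.IsIndepSet.card_le_indepNum fun x hx y hy hxy => ?_)
    (SimpleGraph.IsIndepSet.card_le_indepNum fun x hx y hy hxy => ?_)
  · simpa using hI.isIndepSet (by simpa using hx) (by simpa using hy) (Sum.inl_injective.ne hxy)
  · simpa using hI.isIndepSet (by simpa using hx) (by simpa using hy) (Sum.inr_injective.ne hxy)

end Ramsey

section InverseRamsey

theorem Q_le_indepNum {V : Type*} [Fintype V] {G : SimpleGraph V} {t n : ℕ} (hG : G.CliqueFree t)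
    (hn : n ≤ Fintype.card V) : Q t n ≤ G.indepNum := by
  obtain ⟨e⟩ : Nonempty (Fin n ↪ V) := Function.Embedding.nonempty_of_card_le (by simpa)
  refine le_trans (Nat.sInf_le ⟨G.comap e, ?_, rfl⟩) (indepNum_comap_le G e)
  exact hG.comap (SimpleGraph.Embedding.comap e G).isContained

theorem exists_indepNum_eq_Q {t : ℕ} (ht : 2 ≤ t) (n : ℕ) :
    ∃ G : SimpleGraph (Fin n), G.CliqueFree t ∧ G.indepNum = Q t n :=
  Nat.sInf_mem (s := {a : ℕ | ∃ G : SimpleGraph (Fin n), G.CliqueFree t ∧ G.indepNum = a})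
    ⟨_, ⊥, SimpleGraph.cliqueFree_bot ht, rfl⟩

theorem Q_mono {t : ℕ} (ht : 2 ≤ t) : Monotone (Q t) := by
  intro a b hab
  obtain ⟨G, hG, hG'⟩ := exists_indepNum_eq_Q ht b
  exact hG' ▸ Q_le_indepNum hG (by simpa)

theorem Q_add_le {t : ℕ} (ht : 2 ≤ t) (a b : ℕ) : Q t (a + b) ≤ Q t a + Q t b := by
  obtain ⟨G, hG, hGQ⟩ := exists_indepNum_eq_Q ht a
  obtain ⟨H, hH, hHQ⟩ := exists_indepNum_eq_Q ht b
  exact hGQ ▸ hHQ ▸ (Q_le_indepNum (cliqueFree_sum hG hH) (by simp)).trans (indepNum_sum_le G H)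

theorem Q_zero {t : ℕ} (ht : 2 ≤ t) : Q t 0 = 0 := by
  obtain ⟨G, -, hGQ⟩ := exists_indepNum_eq_Q ht 0
  obtain ⟨I, hI⟩ := G.exists_isNIndepSet_indepNum
  rw [← hGQ, ← hI.card_eq, Finset.card_eq_zero]
  exact Finset.eq_empty_of_isEmpty I

theorem Q_mul_le {t : ℕ} (ht : 2 ≤ t) (q n : ℕ) : Q t (q * n) ≤ q * Q t n := by
  induction q with
  | zero => simp [Q_zero ht]
  | succ q ih =>
    rw [Nat.succ_mul, Nat.succ_mul]
    exact (Q_add_le ht _ _).trans (Nat.add_le_add_right ih _)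

theorem ramseyNumber_Q_le (t n : ℕ) : ramseyNumber t (Q t n) ≤ n := by
  refine IsRamsey.ramseyNumber_le fun G => or_iff_not_imp_left.2 fun hG hindep => ?_
  have hQ := Q_le_indepNum (not_not.1 hG) (n := n) (by simp)
  obtain ⟨I, hI⟩ := G.exists_isNIndepSet_indepNum
  obtain ⟨J, hJI, hJ⟩ := Finset.exists_subset_card_eq (hI.card_eq ▸ hQ)
  exact hindep J ⟨hI.isIndepSet.mono (by exact_mod_cast hJI), hJ⟩

theorem lt_ramseyNumber_Q_succ {t : ℕ} (ht : 2 ≤ t) (n : ℕ) :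
    n < ramseyNumber t (Q t n + 1) := by
  by_contra! h
  obtain ⟨G, hG, hG'⟩ := exists_indepNum_eq_Q ht n
  exact not_cliqueFreeOn_of_indepNum_lt (Nat.lt_succ_of_le hG'.le) (U := Finset.univ)
    (by simpa) hG.cliqueFreeOn

theorem lt_Q_succ_pow {t : ℕ} (ht : 2 ≤ t) (n : ℕ) : n < (Q t n + 1) ^ t :=
  (lt_ramseyNumber_Q_succ ht n).trans_le (ramseyNumber_le_pow _ _)

theorem tendsto_Q {t : ℕ} (ht : 2 ≤ t) : Tendsto (Q t) atTop atTop := by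
  refine tendsto_atTop.2 fun b => ?_
  filter_upwards [eventually_ge_atTop (b ^ t)] with n hn
  have h := hn.trans_lt (lt_Q_succ_pow ht n)
  have := lt_of_pow_lt_pow_left₀ t (Nat.zero_le _) h
  omega

end InverseRamsey

section DependentRandomChoice

variable {V Y : Type*} [DecidableEq Y]

theorem sum_card_filter_forall_mem [Fintype Y] (s : Finset V) (A : V → Finset Y) (q : ℕ) :
    ∑ f : Fin q → Y, #{x ∈ s | ∀ i, f i ∈ A x} = ∑ x ∈ s, #(A x) ^ q := by
  simp_rw [card_filter]
  rw [sum_comm]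
  refine sum_congr rfl fun x _ => ?_
  rw [← card_filter, ← Fintype.card_piFinset_const]
  congr 1
  ext f
  simp

theorem exists_card_le_forall_not_disjoint (𝓑 : Finset (Finset V))
    (h𝓑 : ∀ X ∈ 𝓑, X.Nonempty) : ∃ D : Finset V, #D ≤ #𝓑 ∧ ∀ X ∈ 𝓑, ¬ Disjoint X D := by
  classical
  choose g hg using h𝓑
  refine ⟨𝓑.attach.image fun X => g X.1 X.2, card_image_le.trans card_attach.le, fun X hX => ?_⟩
  exact not_disjoint_iff.2 ⟨g X hX, hg X hX, mem_image.2 ⟨⟨X, hX⟩, mem_attach _ _, rfl⟩⟩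

theorem card_mul_pow_le_sum_pow [Fintype V] {w : V → ℝ} (hw : ∀ x, 0 ≤ w x) {a : ℝ} (ha : 0 ≤ a)
    (haw : Fintype.card V * a ≤ ∑ x, w x) (q : ℕ) :
    Fintype.card V * a ^ (q + 1) ≤ ∑ x, w x ^ (q + 1) := by
  rcases isEmpty_or_nonempty V with hV | hV
  · simp
  have : (0 : ℝ) < Fintype.card V := by exact_mod_cast Fintype.card_pos
  refine le_trans ?_ (pow_sum_div_card_le_sum_pow (fun x _ => hw x) q)
  rw [card_univ, le_div_iff₀ (by positivity)]
  calc Fintype.card V * a ^ (q + 1) * (Fintype.card V : ℝ) ^ q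
      = (Fintype.card V * a) ^ (q + 1) := by ring
    _ ≤ _ := by gcongr

theorem exists_forall_card_eq_le_card_inf [Fintype V] [Fintype Y] [Nonempty Y]
    (A : V → Finset Y) {r : ℕ} (hr : 0 < r) (q : ℕ) {p δ : ℝ} (hp : 0 ≤ p) (hδ : 0 ≤ δ)
    (hA : Fintype.card V * (p * Fintype.card Y) ≤ ∑ x, (#(A x) : ℝ)) :
    ∃ U : Finset V,
      Fintype.card V * p ^ (q + 1) - (Fintype.card V).choose r * δ ^ (q + 1) ≤ #U ∧
      ∀ X ⊆ U, #X = r → δ * Fintype.card Y ≤ #(X.inf A) := by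
  classical
  set M : ℝ := (Fintype.card Y : ℝ)
  let 𝓑 : Finset (Finset V) := {X ∈ univ.powersetCard r | (#(X.inf A) : ℝ) < δ * M}
  let U (f : Fin (q + 1) → Y) : Finset V := {x | ∀ i, f i ∈ A x}
  let bad (f : Fin (q + 1) → Y) : Finset (Finset V) := {X ∈ 𝓑 | ∀ i, f i ∈ X.inf A}
  have hU : M ^ (q + 1) * (Fintype.card V * p ^ (q + 1)) ≤ ∑ f, (#(U f) : ℝ) := by
    have hsum : ∑ f, (#(U f) : ℝ) = ∑ x, (#(A x) : ℝ) ^ (q + 1) := by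
      exact_mod_cast sum_card_filter_forall_mem univ A (q + 1)
    rw [hsum]
    refine le_of_eq_of_le (by ring) (card_mul_pow_le_sum_pow (fun x => by positivity)
      (by positivity) hA q)
  have hbad : ∑ f, (#(bad f) : ℝ) ≤ M ^ (q + 1) * ((Fintype.card V).choose r * δ ^ (q + 1)) := by
    calc ∑ f, (#(bad f) : ℝ) = ∑ X ∈ 𝓑, (#(X.inf A) : ℝ) ^ (q + 1) := by
          exact_mod_cast sum_card_filter_forall_mem 𝓑 (fun X => X.inf A) (q + 1)
      _ ≤ ∑ _X ∈ 𝓑, (δ * M) ^ (q + 1) := by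
          gcongr with X hX
          exact (mem_filter.1 hX).2.le
      _ ≤ ∑ _X ∈ univ.powersetCard r, (δ * M) ^ (q + 1) :=
          sum_le_sum_of_subset_of_nonneg (filter_subset _ _) fun _ _ _ => by positivity
      _ = M ^ (q + 1) * ((Fintype.card V).choose r * δ ^ (q + 1)) := by
          simp [card_powersetCard]
          ring
  obtain ⟨f, -, hf⟩ : ∃ f ∈ univ, (Fintype.card V * p ^ (q + 1) -
      (Fintype.card V).choose r * δ ^ (q + 1) : ℝ) ≤ #(U f) - #(bad f) := by
    refine exists_le_of_sum_le univ_nonempty ?_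
    rw [sum_const, card_univ, Fintype.card_fun, Fintype.card_fin, nsmul_eq_mul, sum_sub_distrib,
      mul_sub, Nat.cast_pow]
    exact sub_le_sub hU hbad
  obtain ⟨D, hDcard, hD⟩ := exists_card_le_forall_not_disjoint (bad f) fun X hX => by
    rw [← card_pos, (mem_powersetCard.1 (mem_filter.1 (mem_filter.1 hX).1).1).2]
    exact hr
  refine ⟨U f \ D, ?_, fun X hX hXr => ?_⟩
  · have hsub : (#(U f) : ℝ) ≤ #(U f \ D) + #(bad f) := by
      exact_mod_cast card_le_card_sdiff_add_card.trans (by gcongr)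
    linarith
  · by_contra! hlt
    refine hD X ?_ (disjoint_of_subset_left hX sdiff_disjoint)
    simp only [bad, 𝓑, mem_filter, mem_powersetCard_univ, mem_inf]
    exact ⟨⟨hXr, hlt⟩, fun i x hx => (mem_filter.1 (mem_sdiff.1 (hX hx)).1).2 i⟩

end DependentRandomChoice

section LargeSetsContainClique

variable {V : Type*} {G : SimpleGraph V} {r : ℕ} {L L' : ℝ}

/-- The `K_r`-independence number of `G`, the largest size of a vertex set spanning no `r`-clique,
is less than `L`. -/
def LargeSetsContainClique (G : SimpleGraph V) (r : ℕ) (L : ℝ) : Prop :=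
  ∀ U : Finset V, L ≤ #U → ∃ C ⊆ U, G.IsNClique r C

theorem largeSetsContainClique_iff :
    LargeSetsContainClique G r L ↔ ∀ U : Finset V, L ≤ #U → ¬ G.CliqueFreeOn U r := by
  simp [LargeSetsContainClique, SimpleGraph.CliqueFreeOn]

theorem LargeSetsContainClique.mono (h : LargeSetsContainClique G r L) (hL : L ≤ L') :
    LargeSetsContainClique G r L' :=
  fun U hU => h U (hL.trans hU)

theorem LargeSetsContainClique.induce (h : LargeSetsContainClique G r L) (s : Set V) :
    LargeSetsContainClique (G.induce s) r L := by
  intro U hU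
  obtain ⟨C, hCU, hC⟩ := h (U.map (.subtype _)) (by simpa using hU)
  obtain ⟨C', hC'U, rfl⟩ := subset_map_iff.1 hCU
  exact ⟨C', hC'U, (SimpleGraph.isNClique_induce_iff s C' r).2 hC⟩

theorem isNClique_union [DecidableEq V] {a b : ℕ} {X T : Finset V} (hX : G.IsNClique a X)
    (hT : G.IsNClique b T) (h : ∀ x ∈ X, ∀ y ∈ T, G.Adj x y) :
    G.IsNClique (a + b) (X ∪ T) := by
  have : Std.Symm G.Adj := ⟨fun _ _ h => h.symm⟩
  refine ⟨?_, ?_⟩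
  · rw [coe_union, SimpleGraph.IsClique, Set.pairwise_union_of_symm]
    exact ⟨hX.isClique, hT.isClique, fun x hx y hy _ => h x hx y hy⟩
  · have hdisj : Disjoint X T := disjoint_left.2 fun x hxX hxT => (h x hxX x hxT).ne rfl
    rw [card_union_of_disjoint hdisj, hX.card_eq, hT.card_eq]

end LargeSetsContainClique

section CliqueTuples

variable {V : Type*} {G : SimpleGraph V}

/-- The entries of `v` are pairwise adjacent, i.e. `v` is a clique with an ordering. -/
def IsCliqueTuple (G : SimpleGraph V) {j : ℕ} (v : Fin j → V) : Prop :=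
  Pairwise fun a b => G.Adj (v a) (v b)

theorem isCliqueTuple_cons {j : ℕ} {x : V} {v : Fin j → V} :
    IsCliqueTuple G (Fin.cons x v : Fin (j + 1) → V) ↔
      (∀ a, G.Adj x (v a)) ∧ IsCliqueTuple G v := by
  have : Std.Symm fun a b => G.Adj ((Fin.cons x v : Fin (j + 1) → V) a)
    ((Fin.cons x v : Fin (j + 1) → V) b) := ⟨fun _ _ h => h.symm⟩
  simp only [IsCliqueTuple, pairwise_fin_succ_iff_of_isSymm, Fin.cons_zero, Fin.cons_succ]

/-- The tuples that `x` can be prepended to within the set `S` of tuples. -/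
noncomputable def link {j : ℕ} (S : Finset (Fin (j + 1) → V)) (x : V) : Finset (Fin j → V) :=
  S.preimage (Fin.cons (α := fun _ => V) x) (Fin.cons_right_injective _).injOn

theorem mem_link {j : ℕ} {S : Finset (Fin (j + 1) → V)} {x : V} {v : Fin j → V} :
    v ∈ link S x ↔ (Fin.cons x v : Fin (j + 1) → V) ∈ S :=
  mem_preimage

theorem sum_card_link [Fintype V] {j : ℕ} (S : Finset (Fin (j + 1) → V)) :
    ∑ x, #(link S x) = #S := by
  classical
  rw [card_eq_sum_card_fiberwise (f := fun v => v 0) (t := univ) (by simp)]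
  refine sum_congr rfl fun x _ => ?_
  rw [← card_map ⟨Fin.cons (α := fun _ => V) x, Fin.cons_right_injective _⟩]
  congr 1
  ext v
  cases v using Fin.consCases with
  | _ y w =>
    simp only [Finset.mem_map, Function.Embedding.coeFn_mk, mem_filter, mem_link, Fin.cons_zero,
      Fin.cons_inj]
    grind

end CliqueTuples

section BlowUp

theorem eventually_rpow_le_rpow_half_sub_one {ε : ℝ} (hε : 0 < ε) (hε1 : ε ≤ 1) :
    ∀ᶠ N : ℕ in atTop, (N : ℝ) ^ (1 - ε) ≤ (N : ℝ) ^ (1 - ε / 2) - 1 := by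
  have htwo := ((tendsto_rpow_atTop (half_pos hε)).comp
    tendsto_natCast_atTop_atTop).eventually_ge_atTop 2
  filter_upwards [htwo, eventually_ge_atTop 1] with N (htwo : (2 : ℝ) ≤ (N : ℝ) ^ (ε / 2)) hN
  have hN : (1 : ℝ) ≤ N := by exact_mod_cast hN
  have hsplit : (N : ℝ) ^ (1 - ε / 2) = (N : ℝ) ^ (1 - ε) * (N : ℝ) ^ (ε / 2) := by
    rw [← Real.rpow_add (by linarith)]
    ring_nf
  have hone : 1 ≤ (N : ℝ) ^ (1 - ε) := Real.one_le_rpow hN (by linarith)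
  nlinarith

theorem exists_eventually_exists_isNClique_rpow_le_card_inf {ε : ℝ} (hε : 0 < ε) (hε1 : ε ≤ 1)
    {r : ℕ} (hr : 0 < r) {δ' : ℝ} (hδ' : 0 < δ') :
    ∃ δ : ℝ, 0 < δ ∧ ∀ᶠ N : ℕ in atTop, ∀ (V : Type*) [Fintype V] (Y : Type*) [Fintype Y]
      [Nonempty Y] [DecidableEq Y] (G : SimpleGraph V) (A : V → Finset Y), Fintype.card V = N →
      LargeSetsContainClique G r ((N : ℝ) ^ (1 - ε)) →
      (N : ℝ) ^ (1 - δ) * Fintype.card Y ≤ ∑ x, (#(A x) : ℝ) →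
      ∃ X : Finset V, G.IsNClique r X ∧ (N : ℝ) ^ (-δ') * Fintype.card Y ≤ #(X.inf A) := by
  classical
  obtain ⟨q, hq⟩ := exists_nat_ge (r / δ')
  have hrq : (r : ℝ) ≤ δ' * (q + 1) := by
    rw [div_le_iff₀ hδ'] at hq
    linarith
  set δ := ε / (2 * (q + 1)) with hδ
  refine ⟨δ, by positivity, ?_⟩
  filter_upwards [eventually_rpow_le_rpow_half_sub_one hε hε1, eventually_ge_atTop 1] with
    N hlarge hN V _ Y _ _ _ G A hV hG hA
  have hN1 : (1 : ℝ) ≤ N := by exact_mod_cast hN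
  have hN0 : (0 : ℝ) < N := by linarith
  obtain ⟨U, hU, hUA⟩ := exists_forall_card_eq_le_card_inf A hr q
    (p := (N : ℝ) ^ (-δ)) (δ := (N : ℝ) ^ (-δ')) (by positivity) (by positivity) (by
      refine le_of_eq_of_le ?_ hA
      rw [hV, sub_eq_add_neg, Real.rpow_add hN0, Real.rpow_one, mul_assoc])
  have hmain : (N : ℝ) * ((N : ℝ) ^ (-δ)) ^ (q + 1) = (N : ℝ) ^ (1 - ε / 2) := by
    rw [← Real.rpow_mul_natCast hN0.le, sub_eq_add_neg, Real.rpow_add hN0, Real.rpow_one, hδ]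
    push_cast
    field_simp
  have hbad : (N.choose r : ℝ) * ((N : ℝ) ^ (-δ')) ^ (q + 1) ≤ 1 := by
    calc (N.choose r : ℝ) * ((N : ℝ) ^ (-δ')) ^ (q + 1)
        ≤ (N : ℝ) ^ r * ((N : ℝ) ^ (-δ')) ^ (q + 1) := by
          gcongr
          exact_mod_cast N.choose_le_pow r
      _ = (N : ℝ) ^ (r - δ' * (q + 1)) := by
          rw [← Real.rpow_mul_natCast hN0.le, ← Real.rpow_natCast, ← Real.rpow_add hN0]
          push_cast
          ring_nf
      _ ≤ 1 := Real.rpow_le_one_of_one_le_of_nonpos hN1 (by linarith)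
  rw [hV, hmain] at hU
  obtain ⟨X, hXU, hX⟩ := hG U (by linarith)
  exact ⟨X, hX, hUA X hXU hX.card_eq⟩

theorem exists_isNClique_mul_of_rpow_le_card {ε : ℝ} (hε : 0 < ε) (hε1 : ε ≤ 1) {r : ℕ}
    (hr : 0 < r) (j : ℕ) :
    ∃ δ : ℝ, 0 < δ ∧ ∀ᶠ N : ℕ in atTop, ∀ (V : Type*) [Fintype V] (G : SimpleGraph V),
      Fintype.card V = N → LargeSetsContainClique G r ((N : ℝ) ^ (1 - ε)) →
      ∀ S : Finset (Fin j → V), (∀ v ∈ S, IsCliqueTuple G v) →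
        (N : ℝ) ^ (j - δ) ≤ #S →
        ∃ T : Finset V, G.IsNClique (j * r) T ∧ ∀ x ∈ T, ∃ v ∈ S, x ∈ Set.range v := by
  classical
  induction j with
  | zero => exact ⟨1, one_pos, .of_forall fun N V _ G _ _ S _ _ => ⟨∅, by simp, by simp⟩⟩
  | succ j ih =>
    obtain ⟨δ', hδ', ih⟩ := ih
    obtain ⟨δ, hδ, hDRC⟩ := exists_eventually_exists_isNClique_rpow_le_card_inf hε hε1 hr hδ'
    refine ⟨δ, hδ, ?_⟩
    filter_upwards [ih, hDRC, eventually_gt_atTop 0] with N ih hDRC hN V _ G hV hG S hS hcard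
    have hN0 : (0 : ℝ) < N := by exact_mod_cast hN
    have : Nonempty V := Fintype.card_pos_iff.1 (by omega)
    have htuples : (Fintype.card (Fin j → V) : ℝ) = (N : ℝ) ^ j := by simp [hV]
    obtain ⟨X, hX, hXS⟩ := hDRC V (Fin j → V) G (link S) hV hG (by
      refine le_of_eq_of_le ?_ (hcard.trans_eq (by exact_mod_cast (sum_card_link S).symm))
      rw [htuples, ← Real.rpow_natCast, ← Real.rpow_add hN0]
      push_cast
      ring_nf)
    rw [htuples, ← Real.rpow_natCast, ← Real.rpow_add hN0, neg_add_eq_sub] at hXS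
    have hlink {y : Fin j → V} (hy : y ∈ X.inf (link S)) {x : V} (hx : x ∈ X) :
        (Fin.cons x y : Fin (j + 1) → V) ∈ S := mem_link.1 (mem_inf.1 hy x hx)
    obtain ⟨x₀, hx₀⟩ : X.Nonempty := card_pos.1 (hX.card_eq ▸ hr)
    obtain ⟨y₀, hy₀⟩ : (X.inf (link S)).Nonempty := by
      rw [← card_pos, ← Nat.cast_pos (α := ℝ)]
      exact hXS.trans_lt' (by positivity)
    obtain ⟨T, hT, hTS⟩ := ih V G hV hG (X.inf (link S))
      (fun v hv => (isCliqueTuple_cons.1 (hS _ (hlink hv hx₀))).2) hXS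
    refine ⟨X ∪ T, ?_, fun x hx => ?_⟩
    · rw [Nat.succ_mul, add_comm]
      refine isNClique_union hX hT fun x hx y hy => ?_
      obtain ⟨v, hv, a, rfl⟩ := hTS y hy
      exact (isCliqueTuple_cons.1 (hS _ (hlink hv hx))).1 a
    · rcases mem_union.1 hx with hxX | hxT
      · exact ⟨_, hlink hy₀ hxX, 0, by simp⟩
      · obtain ⟨v, hv, a, rfl⟩ := hTS x hxT
        exact ⟨_, hlink hv hx₀, a.succ, by simp⟩

end BlowUp

section CommonNeighbors

variable {V ι : Type*} {G : SimpleGraph V}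

open Classical in
/-- The vertices of `B` adjacent to `v a` for every `a ∈ s`. -/
noncomputable def commonNeighborsIn (G : SimpleGraph V) (B : Finset V) (v : ι → V)
    (s : Finset ι) : Finset V :=
  {x ∈ B | ∀ a ∈ s, G.Adj (v a) x}

open Classical in
theorem mem_commonNeighborsIn {B : Finset V} {v : ι → V} {s : Finset ι} {x : V} :
    x ∈ commonNeighborsIn G B v s ↔ x ∈ B ∧ ∀ a ∈ s, G.Adj (v a) x :=
  mem_filter

open Classical in
theorem card_sub_mul_le_card_commonNeighborsIn {B : Finset V} {v : ι → V} {s : Finset ι} {D : ℝ}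
    (h : ∀ a ∈ s, (#{x ∈ B | ¬ G.Adj (v a) x} : ℝ) ≤ D) :
    (#B : ℝ) - #s * D ≤ #(commonNeighborsIn G B v s) := by
  have hcover : B ⊆ commonNeighborsIn G B v s ∪ s.biUnion fun a => {x ∈ B | ¬ G.Adj (v a) x} := by
    intro x hx
    simp only [mem_union, mem_commonNeighborsIn, mem_biUnion, mem_filter]
    grind
  have hcard : (#B : ℝ) ≤
      #(commonNeighborsIn G B v s) + ∑ a ∈ s, (#{x ∈ B | ¬ G.Adj (v a) x} : ℝ) := by
    exact_mod_cast (card_le_card hcover).trans <|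
      (card_union_le _ _).trans (Nat.add_le_add_left card_biUnion_le _)
  have hsum := sum_le_card_nsmul s _ D h
  rw [nsmul_eq_mul] at hsum
  linarith

open Classical in
theorem card_filter_not_adj_add_degree [Fintype V] (G : SimpleGraph V) (x : V) :
    #{y | ¬ G.Adj x y} + G.degree x = Fintype.card V := by
  rw [← G.card_neighborFinset_eq_degree, G.neighborFinset_eq_filter, add_comm,
    card_filter_add_card_filter_not, card_univ]

variable [Fintype V]

open Classical in
/-- The `j`-cliques of `G`, each counted with all of its `j !` orderings. -/
noncomputable def cliqueTuples (G : SimpleGraph V) (j : ℕ) : Finset (Fin j → V) :=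
  {v | IsCliqueTuple G v}

open Classical in
theorem mem_cliqueTuples {j : ℕ} {v : Fin j → V} :
    v ∈ cliqueTuples G j ↔ IsCliqueTuple G v :=
  mem_filter_univ v

theorem card_cliqueTuples_succ (G : SimpleGraph V) (j : ℕ) :
    #(cliqueTuples G (j + 1)) =
      ∑ v ∈ cliqueTuples G j, #(commonNeighborsIn G univ v univ) := by
  classical
  rw [card_eq_sum_card_fiberwise (f := Fin.tail) (t := cliqueTuples G j)]
  · refine sum_congr rfl fun v hv => ?_
    rw [← card_map ⟨fun x => (Fin.cons x v : Fin (j + 1) → V),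
      Fin.cons_left_injective (α := fun _ => V) v⟩]
    congr 1
    ext w
    cases w using Fin.consCases with
    | _ x w =>
      simp only [mem_filter, mem_cliqueTuples, isCliqueTuple_cons, Fin.tail_cons, Finset.mem_map,
        Function.Embedding.coeFn_mk, mem_commonNeighborsIn, mem_univ, true_and, Fin.cons_inj,
        forall_const, G.adj_comm x] at hv ⊢
      constructor
      · rintro ⟨⟨hx, -⟩, rfl⟩
        exact ⟨x, hx, rfl, rfl⟩
      · rintro ⟨y, hy, rfl, rfl⟩
        exact ⟨⟨hy, hv⟩, rfl⟩
  · intro w hw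
    cases w using Fin.consCases with
    | _ x w => exact mem_cliqueTuples.2 (isCliqueTuple_cons.1 (mem_cliqueTuples.1 hw)).2

open Classical in
theorem pow_le_card_cliqueTuples {d D : ℝ} (hd : 0 ≤ d)
    (hD : ∀ x, (#{y | ¬ G.Adj x y} : ℝ) ≤ D) (j : ℕ)
    (hj : ∀ i < j, d ≤ Fintype.card V - i * D) :
    d ^ j ≤ #(cliqueTuples G j) := by
  induction j with
  | zero =>
    have hmem : Fin.elim0 ∈ cliqueTuples G 0 := mem_cliqueTuples.2 fun a => a.elim0
    simpa using card_pos.2 ⟨_, hmem⟩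
  | succ j ih =>
    have hext (v : Fin j → V) : d ≤ #(commonNeighborsIn G univ v univ) :=
      (hj j j.lt_succ_self).trans <| by
        simpa using card_sub_mul_le_card_commonNeighborsIn (B := univ) (s := univ) fun a _ =>
          hD (v a)
    calc d ^ (j + 1) ≤ #(cliqueTuples G j) * d := by
          rw [pow_succ]
          gcongr
          exact ih fun i hi => hj i (by omega)
      _ = ∑ _v ∈ cliqueTuples G j, d := by rw [sum_const, nsmul_eq_mul]
      _ ≤ ∑ v ∈ cliqueTuples G j, (#(commonNeighborsIn G univ v univ) : ℝ) :=
          sum_le_sum fun v _ => hext v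
      _ = #(cliqueTuples G (j + 1)) := by rw [card_cliqueTuples_succ, Nat.cast_sum]

end CommonNeighbors

section Stability

variable {V : Type*} {G : SimpleGraph V}

open Classical in
/-- The sum of the degrees in `G.induce A`, i.e. twice the number of edges inside `A`. -/
noncomputable def degreeSumOn (G : SimpleGraph V) (A : Finset V) : ℕ :=
  ∑ x ∈ A, #{y ∈ A | G.Adj x y}

open Classical in
theorem card_sub_le_card_filter_of_degreeSumOn_le {A : Finset V} {d e : ℝ} (hd : 0 < d)
    (h : (degreeSumOn G A : ℝ) ≤ d * e) :
    (#A : ℝ) - e ≤ #{x ∈ A | (#{y ∈ A | G.Adj x y} : ℝ) ≤ d} := by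
  set C := {x ∈ A | ¬ (#{y ∈ A | G.Adj x y} : ℝ) ≤ d}
  have hmarkov : d * #C ≤ d * e := by
    calc d * #C = ∑ _x ∈ C, d := by rw [sum_const, nsmul_eq_mul, mul_comm]
      _ ≤ ∑ x ∈ C, (#{y ∈ A | G.Adj x y} : ℝ) :=
          sum_le_sum fun x hx => (not_le.1 (mem_filter.1 hx).2).le
      _ ≤ degreeSumOn G A := by
          rw [degreeSumOn, Nat.cast_sum]
          exact sum_le_sum_of_subset_of_nonneg (filter_subset _ _) fun _ _ _ => Nat.cast_nonneg _
      _ ≤ d * e := h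
  have hCe : (#C : ℝ) ≤ e := le_of_mul_le_mul_left hmarkov hd
  have hsplit := card_filter_add_card_filter_not (s := A)
    (p := fun x => (#{y ∈ A | G.Adj x y} : ℝ) ≤ d)
  rw [← hsplit, Nat.cast_add]
  linarith

theorem IsCliqueTuple.update {k : ℕ} {v : Fin k → V} (hv : IsCliqueTuple G v) {i : Fin k} {x : V}
    (hx : ∀ a ≠ i, G.Adj (v a) x) : IsCliqueTuple G (Function.update v i x) := by
  intro a b hab
  rcases eq_or_ne a i with rfl | ha
  · simpa [hab.symm] using (hx b hab.symm).symm
  rcases eq_or_ne b i with rfl | hb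
  · simpa [hab] using hx a hab
  · simpa [ha, hb] using hv hab

variable [Fintype V] {k : ℕ}

/-- The vertices adjacent to all entries of `v` except possibly the `i`-th. -/
noncomputable def commonNeighborsExcept (G : SimpleGraph V) (v : Fin k → V) (i : Fin k) :
    Finset V :=
  commonNeighborsIn G univ v (univ.erase i)

theorem mem_commonNeighborsExcept {v : Fin k → V} {i : Fin k} {x : V} :
    x ∈ commonNeighborsExcept G v i ↔ ∀ a ≠ i, G.Adj (v a) x := by
  simp [commonNeighborsExcept, mem_commonNeighborsIn]

theorem sum_degreeSumOn_commonNeighborsExcept_le (G : SimpleGraph V) (i : Fin k) :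
    ∑ v ∈ cliqueTuples G k, degreeSumOn G (commonNeighborsExcept G v i) ≤
      Fintype.card V * #(cliqueTuples G (k + 1)) := by
  simp_rw [degreeSumOn, ← card_sigma]
  rw [← card_univ, ← card_product]
  -- Replacing `v i` by the two ends of an edge inside the `i`-th set gives a `(k + 1)`-clique;
  -- recording `v i` as well makes this injective.
  refine card_le_card_of_injOn
    (fun z => (z.1 i, Fin.cons z.2.2 (Function.update z.1 i z.2.1))) ?_ ?_
  · rintro ⟨v, x, y⟩ hz
    simp only [coe_sigma, Set.mem_sigma_iff, mem_coe, mem_cliqueTuples, mem_filter,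
      mem_commonNeighborsExcept] at hz
    obtain ⟨hv, hx, hy, hxy⟩ := hz
    simp only [coe_product, Set.mem_prod, mem_coe, mem_univ, true_and, mem_cliqueTuples,
      isCliqueTuple_cons]
    refine ⟨fun a => ?_, hv.update hx⟩
    rcases eq_or_ne a i with rfl | ha
    · simpa using hxy.symm
    · simpa [ha] using (hy a ha).symm
  · rintro ⟨v, x, y⟩ - ⟨v', x', y'⟩ - h
    simp only [Prod.mk.injEq, Fin.cons_inj] at h
    obtain ⟨hvi, rfl, hupdate⟩ := h
    have hx : x = x' := by simpa using congrFun hupdate i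
    have hv : v = v' := by
      rw [← Function.update_eq_self i v, ← Function.update_idem x, hupdate, hvi,
        Function.update_idem, Function.update_eq_self]
    rw [hx, hv]

theorem exists_mem_cliqueTuples_sum_degreeSumOn_add_le (hne : (cliqueTuples G k).Nonempty) {M : ℝ}
    (hfew : (k + 1) * Fintype.card V * #(cliqueTuples G (k + 1)) ≤ M * #(cliqueTuples G k)) :
    ∃ v ∈ cliqueTuples G k, ∑ i, (degreeSumOn G (commonNeighborsExcept G v i) : ℝ) +
      Fintype.card V * #(commonNeighborsIn G univ v univ) ≤ M := by
  refine exists_le_of_sum_le hne ?_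
  have hinner (i : Fin k) :
      ∑ v ∈ cliqueTuples G k, (degreeSumOn G (commonNeighborsExcept G v i) : ℝ) ≤
        Fintype.card V * #(cliqueTuples G (k + 1)) := by
    exact_mod_cast sum_degreeSumOn_commonNeighborsExcept_le G i
  have hsum := sum_le_card_nsmul univ _ _ fun i _ => hinner i
  rw [card_univ, Fintype.card_fin, nsmul_eq_mul] at hsum
  have hfull : (#(cliqueTuples G (k + 1)) : ℝ) =
      ∑ v ∈ cliqueTuples G k, (#(commonNeighborsIn G univ v univ) : ℝ) := by
    exact_mod_cast card_cliqueTuples_succ G k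
  rw [sum_add_distrib, sum_comm, ← mul_sum, ← hfull, sum_const, nsmul_eq_mul]
  linarith

open Classical in
theorem card_filter_not_adj_add_card_le {v : Fin k → V} {i j : Fin k} (hij : i ≠ j) (x : V) :
    #{y ∈ commonNeighborsExcept G v j | ¬ G.Adj x y} + #(commonNeighborsExcept G v i) ≤
      #{y | ¬ G.Adj x y} + #{y ∈ commonNeighborsExcept G v i | G.Adj x y} +
        #(commonNeighborsIn G univ v univ) := by
  set A := commonNeighborsExcept G v with hA
  have hunion : {y ∈ A j | ¬ G.Adj x y} ∪ {y ∈ A i | ¬ G.Adj x y} ⊆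
      ({y | ¬ G.Adj x y} : Finset V) := by
    intro y hy
    simp only [mem_union, mem_filter, mem_univ, true_and] at hy ⊢
    tauto
  have hinter : {y ∈ A j | ¬ G.Adj x y} ∩ {y ∈ A i | ¬ G.Adj x y} ⊆
      commonNeighborsIn G univ v univ := by
    intro y hy
    simp only [mem_inter, mem_filter, hA, mem_commonNeighborsExcept, mem_commonNeighborsIn,
      mem_univ, true_and, forall_const] at hy ⊢
    grind
  have hsplit : #{y ∈ A i | G.Adj x y} + #{y ∈ A i | ¬ G.Adj x y} = #(A i) :=
    card_filter_add_card_filter_not _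
  have hincl := card_union_add_card_inter {y ∈ A j | ¬ G.Adj x y} {y ∈ A i | ¬ G.Adj x y}
  have hunion' := card_le_card hunion
  have hinter' := card_le_card hinter
  omega

open Classical in
theorem exists_almost_complete_parts (hk : 0 < k) {γ : ℝ} (hγ : 0 < γ) (hγ1 : γ ≤ 1)
    (hV : 0 < Fintype.card V)
    (hdeg : ∀ x, (#{y | ¬ G.Adj x y} : ℝ) ≤ (1 / k + γ) * Fintype.card V)
    (hne : (cliqueTuples G k).Nonempty)
    (hfew : (k + 1) * Fintype.card V * #(cliqueTuples G (k + 1)) ≤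
      (γ * Fintype.card V) ^ 2 * #(cliqueTuples G k)) :
    ∃ B : Fin k → Finset V, (∀ i, (1 / k - k * γ) * Fintype.card V ≤ #(B i)) ∧
      ∀ i j, i ≠ j → ∀ x ∈ B i,
        (#{y ∈ B j | ¬ G.Adj x y} : ℝ) ≤ (k + 2) * γ * Fintype.card V := by
  obtain ⟨v, -, hv⟩ := exists_mem_cliqueTuples_sum_degreeSumOn_add_le hne hfew
  set N : ℝ := (Fintype.card V : ℝ) with hN
  have hN0 : 0 < N := by rw [hN]; exact_mod_cast hV
  have hk0 : (0 : ℝ) < k := by exact_mod_cast hk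
  set A := commonNeighborsExcept G v with hA
  have hinner (i : Fin k) : (degreeSumOn G (A i) : ℝ) ≤ (γ * N) * (γ * N) := by
    have hsingle := single_le_sum (f := fun i => (degreeSumOn G (A i) : ℝ))
      (fun i _ => Nat.cast_nonneg _) (mem_univ i)
    have hfull : 0 ≤ N * #(commonNeighborsIn G univ v univ) := by positivity
    linarith
  have hfull : (#(commonNeighborsIn G univ v univ) : ℝ) ≤ γ * N := by
    have hsum : 0 ≤ ∑ i, (degreeSumOn G (A i) : ℝ) := by positivity
    refine le_of_mul_le_mul_left ?_ hN0
    calc N * #(commonNeighborsIn G univ v univ) ≤ γ * (γ * N ^ 2) := by linarith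
      _ ≤ 1 * (γ * N ^ 2) := by gcongr
      _ = N * (γ * N) := by ring
  have hcard (i : Fin k) : (1 / k - (k - 1) * γ) * N ≤ #(A i) := by
    refine le_of_eq_of_le ?_
      (card_sub_mul_le_card_commonNeighborsIn (B := univ) fun a _ => hdeg (v a))
    rw [card_erase_of_mem (mem_univ i), card_univ, card_univ, Fintype.card_fin, Nat.cast_pred hk,
      ← hN]
    field_simp
    ring
  refine ⟨fun i => {x ∈ A i | (#{y ∈ A i | G.Adj x y} : ℝ) ≤ γ * N}, fun i => ?_,
    fun i j hij x hx => ?_⟩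
  · have htrim := card_sub_le_card_filter_of_degreeSumOn_le (by positivity) (hinner i)
    linarith [hcard i]
  · have hpart : (#{y ∈ A j | ¬ G.Adj x y} : ℝ) + #(A i) ≤ #{y | ¬ G.Adj x y} +
        #{y ∈ A i | G.Adj x y} + #(commonNeighborsIn G univ v univ) := by
      exact_mod_cast card_filter_not_adj_add_card_le hij x
    have hsub : (#{y ∈ {z ∈ A j | (#{y ∈ A j | G.Adj z y} : ℝ) ≤ γ * N} | ¬ G.Adj x y} : ℝ) ≤
        #{y ∈ A j | ¬ G.Adj x y} := by
      gcongr
      exact filter_subset _ _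
    linarith [hcard i, hdeg x, (mem_filter.1 hx).2]

end Stability

section MinDegree

variable {V : Type*} {G : SimpleGraph V}

open Classical in
theorem exists_isNClique_mul_of_almost_complete_parts {k t : ℕ} {L D : ℝ} (hD : 0 ≤ D)
    (hG : LargeSetsContainClique G t L) (B : Fin k → Finset V)
    (hB : ∀ i, L + k * t * D ≤ #(B i))
    (hadj : ∀ i j, i ≠ j → ∀ x ∈ B i, (#{y ∈ B j | ¬ G.Adj x y} : ℝ) ≤ D) :
    ∃ T : Finset V, G.IsNClique (k * t) T := by
  suffices h : ∀ m ≤ k, ∃ T : Finset V, G.IsNClique (m * t) T ∧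
      ∀ x ∈ T, ∃ i : Fin k, i.val < m ∧ x ∈ B i by
    obtain ⟨T, hT, -⟩ := h k le_rfl
    exact ⟨T, hT⟩
  intro m hm
  induction m with
  | zero => exact ⟨∅, by simp, by simp⟩
  | succ m ih =>
    obtain ⟨T, hT, hTB⟩ := ih (by omega)
    let j : Fin k := ⟨m, hm⟩
    have hcommon := card_sub_mul_le_card_commonNeighborsIn (B := B j) (v := id) (s := T)
      fun x hx => by
        obtain ⟨i, hi, hxi⟩ := hTB x hx
        exact hadj i j (Fin.ne_of_lt hi) x hxi
    have hTcard : (#T : ℝ) * D ≤ k * t * D := by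
      have hm' : (m : ℝ) ≤ k := by exact_mod_cast (by omega : m ≤ k)
      rw [hT.card_eq, Nat.cast_mul]
      gcongr
    obtain ⟨C, hCB, hC⟩ := hG _ (hcommon.trans' (by linarith [hB j]))
    refine ⟨T ∪ C, ?_, fun x hx => ?_⟩
    · rw [Nat.succ_mul]
      exact isNClique_union hT hC fun x hx y hy => (mem_commonNeighborsIn.1 (hCB hy)).2 x hx
    · rcases mem_union.1 hx with hx | hx
      · obtain ⟨i, hi, hxi⟩ := hTB x hx
        exact ⟨i, by omega, hxi⟩
      · exact ⟨j, m.lt_succ_self, (mem_commonNeighborsIn.1 (hCB hx)).1⟩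

variable [Fintype V]

open Classical in
theorem card_filter_not_adj_le_of_le_minDegree {c : ℝ}
    (h : (1 - c) * Fintype.card V ≤ G.minDegree) (x : V) :
    (#{y | ¬ G.Adj x y} : ℝ) ≤ c * Fintype.card V := by
  have hsum : (#{y | ¬ G.Adj x y} : ℝ) + G.degree x = Fintype.card V := by
    exact_mod_cast card_filter_not_adj_add_degree G x
  have hmin : (G.minDegree : ℝ) ≤ G.degree x := by exact_mod_cast G.minDegree_le_degree x
  linarith

open Classical in
theorem pow_le_card_cliqueTuples_of_le_minDegree {k : ℕ} (hk : 0 < k) {γ : ℝ} (hγ : 0 ≤ γ)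
    (hγk : k * γ ≤ 1 / (2 * k)) (hdeg : (1 - (1 / k + γ)) * Fintype.card V ≤ G.minDegree) :
    (1 / (2 * k) * (Fintype.card V : ℝ)) ^ k ≤ #(cliqueTuples G k) := by
  refine pow_le_card_cliqueTuples (by positivity)
    (card_filter_not_adj_le_of_le_minDegree hdeg) k fun i hi => ?_
  have : (0 : ℝ) < k := by exact_mod_cast hk
  have hik : (i : ℝ) ≤ k - 1 := by
    have : (i : ℝ) + 1 ≤ k := by exact_mod_cast hi
    linarith
  have hcoeff : 1 / (2 * k) ≤ 1 - i * (1 / k + γ) := by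
    calc 1 / (2 * (k : ℝ)) = 1 - ((k - 1) * (1 / k) + 1 / (2 * k)) := by
          field_simp
          ring
      _ ≤ 1 - (i * (1 / k) + i * γ) := by
          gcongr
          exact le_trans (by gcongr) hγk
      _ = 1 - i * (1 / k + γ) := by ring
  calc 1 / (2 * k) * (Fintype.card V : ℝ) ≤ (1 - i * (1 / k + γ)) * Fintype.card V := by gcongr
    _ = Fintype.card V - i * ((1 / k + γ) * Fintype.card V) := by ring

open Classical in
theorem exists_isNClique_mul_of_card_cliqueTuples_le {k t : ℕ} (hk : 0 < k) {γ : ℝ} (hγ : 0 < γ)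
    (hγk : 1 / (2 * k) + k * t * ((k + 2) * γ) ≤ 1 / k - k * γ) (hV : 0 < Fintype.card V)
    (hG : LargeSetsContainClique G t (1 / (2 * k) * Fintype.card V))
    (hdeg : (1 - (1 / k + γ)) * Fintype.card V ≤ G.minDegree)
    (hfew : (k + 1) * Fintype.card V * #(cliqueTuples G (k + 1)) ≤
      (γ * Fintype.card V) ^ 2 * (1 / (2 * k) * Fintype.card V) ^ k) :
    ∃ T : Finset V, G.IsNClique (k * t) T := by
  have hk1 : (1 : ℝ) ≤ k := by exact_mod_cast hk
  have : (0 : ℝ) < Fintype.card V := by exact_mod_cast hV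
  have hγk' : k * γ ≤ 1 / (2 * k) := by
    have hhalf : 1 / (k : ℝ) = 1 / (2 * k) + 1 / (2 * k) := by
      field_simp
      norm_num
    have hnonneg : 0 ≤ k * t * ((k + 2) * γ) := by positivity
    linarith
  have hγ1 : γ ≤ 1 := by
    have hinv : 1 / (2 * (k : ℝ)) ≤ 1 := div_le_one_of_le₀ (by linarith) (by linarith)
    nlinarith
  have hmany := pow_le_card_cliqueTuples_of_le_minDegree hk hγ.le hγk' hdeg
  have hne : (cliqueTuples G k).Nonempty := by
    rw [← card_pos, ← Nat.cast_pos (α := ℝ)]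
    exact hmany.trans_lt' (by positivity)
  obtain ⟨B, hB, hadj⟩ := exists_almost_complete_parts hk hγ hγ1 hV
    (card_filter_not_adj_le_of_le_minDegree hdeg) hne (hfew.trans (by gcongr))
  refine exists_isNClique_mul_of_almost_complete_parts (by positivity) hG B (fun i => ?_) hadj
  calc 1 / (2 * k) * Fintype.card V + k * t * ((k + 2) * γ * Fintype.card V)
      = (1 / (2 * k) + k * t * ((k + 2) * γ)) * (Fintype.card V : ℝ) := by ring
    _ ≤ (1 / k - k * γ) * Fintype.card V := by gcongr
    _ ≤ #(B i) := hB i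

theorem eventually_rpow_sub_le_mul_rpow {c δ : ℝ} (hc : 0 < c) (hδ : 0 < δ) (a : ℝ) :
    ∀ᶠ N : ℕ in atTop, (N : ℝ) ^ (a - δ) ≤ c * (N : ℝ) ^ a := by
  have hlim := (tendsto_rpow_atTop hδ).comp tendsto_natCast_atTop_atTop
  filter_upwards [hlim.eventually_ge_atTop c⁻¹, eventually_gt_atTop 0] with
    N (hcN : c⁻¹ ≤ (N : ℝ) ^ δ) hN
  rw [Real.rpow_sub (by exact_mod_cast hN), div_le_iff₀ (by positivity)]
  rw [inv_le_iff_one_le_mul₀' hc] at hcN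
  calc (N : ℝ) ^ a = 1 * (N : ℝ) ^ a := (one_mul _).symm
    _ ≤ c * (N : ℝ) ^ δ * (N : ℝ) ^ a := by gcongr
    _ = c * (N : ℝ) ^ a * (N : ℝ) ^ δ := by ring

open Classical in
theorem eventually_exists_isNClique_mul_of_le_minDegree {ε η : ℝ} (hε : 0 < ε) (hε1 : ε ≤ 1)
    (hη : 0 < η) {r k : ℕ} (hr : 0 < r) (hk : 0 < k) :
    ∀ᶠ N : ℕ in atTop, ∀ (V : Type*) [Fintype V] (G : SimpleGraph V), Fintype.card V = N →
      LargeSetsContainClique G r ((N : ℝ) ^ (1 - ε)) → (1 - 1 / k + η) * N ≤ G.minDegree →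
      ∃ T : Finset V, G.IsNClique ((k + 1) * r) T := by
  obtain ⟨δ, hδ, hblowup⟩ := exists_isNClique_mul_of_rpow_le_card hε hε1 hr (k + 1)
  filter_upwards [hblowup, eventually_gt_atTop 0,
    eventually_rpow_sub_le_mul_rpow (pow_pos hη (k + 1)) hδ (k + 1 : ℕ)] with
    N hblowup hN hNδ V _ G hV hG hdeg
  have hnonadj (x : V) : (#{y | ¬ G.Adj x y} : ℝ) ≤ (1 / k - η) * N := by
    rw [← hV] at hdeg ⊢
    exact card_filter_not_adj_le_of_le_minDegree (le_of_eq_of_le (by ring) hdeg) x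
  obtain ⟨x⟩ : Nonempty V := Fintype.card_pos_iff.1 (by omega)
  have hD0 : 0 ≤ (1 / k - η) * N := (hnonadj x).trans' (Nat.cast_nonneg _)
  have hk1 : (1 : ℝ) ≤ k := by exact_mod_cast hk
  have hmany : (η * N) ^ (k + 1) ≤ #(cliqueTuples G (k + 1)) := by
    refine pow_le_card_cliqueTuples (by positivity) hnonadj (k + 1) fun i hi => ?_
    have hik : (i : ℝ) ≤ k := by exact_mod_cast Nat.lt_succ_iff.1 hi
    have hkD : (k : ℝ) * ((1 / k - η) * N) = N - k * (η * N) := by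
      field_simp
    have hiD : (i : ℝ) * ((1 / k - η) * N) ≤ k * ((1 / k - η) * N) := by gcongr
    have hkη : 1 * (η * N) ≤ k * (η * N) := by gcongr
    rw [hV]
    linarith
  rw [Real.rpow_natCast, ← mul_pow] at hNδ
  obtain ⟨T, hT, -⟩ := hblowup V G hV hG (cliqueTuples G (k + 1))
    (fun v hv => mem_cliqueTuples.1 hv) (hNδ.trans hmany)
  exact ⟨T, hT⟩

open Classical in
theorem exists_eventually_exists_isNClique_mul_of_le_minDegree {ε : ℝ} (hε : 0 < ε)
    (hε1 : ε ≤ 1) {r k : ℕ} (hr : 0 < r) (hk : 0 < k) (t : ℕ) :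
    ∃ γ : ℝ, 0 < γ ∧ ∀ᶠ N : ℕ in atTop, ∀ (V : Type*) [Fintype V] (G : SimpleGraph V),
      Fintype.card V = N → LargeSetsContainClique G r ((N : ℝ) ^ (1 - ε)) →
      LargeSetsContainClique G t (1 / (2 * k) * N) → (1 - (1 / k + γ)) * N ≤ G.minDegree →
      ∃ T : Finset V, G.IsNClique ((k + 1) * r) T ∨ G.IsNClique (k * t) T := by
  obtain ⟨δ, hδ, hblowup⟩ := exists_isNClique_mul_of_rpow_le_card hε hε1 hr (k + 1)
  have : (0 : ℝ) < k := by exact_mod_cast hk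
  obtain ⟨γ, hγ, hγk⟩ : ∃ γ : ℝ, 0 < γ ∧
      1 / (2 * k) + k * t * ((k + 2) * γ) ≤ 1 / k - k * γ := by
    refine ⟨1 / (2 * k ^ 2 * (1 + t * (k + 2))), by positivity, le_of_eq ?_⟩
    field_simp
    ring
  refine ⟨γ, hγ, ?_⟩
  filter_upwards [hblowup, eventually_gt_atTop 0, eventually_rpow_sub_le_mul_rpow
    (c := γ ^ 2 * (1 / (2 * k)) ^ k / (k + 1)) (by positivity) hδ (k + 1 : ℕ)] with
    N hblowup hN hNδ V _ G hV hG hGt hdeg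
  rcases le_or_gt ((N : ℝ) ^ ((k + 1 : ℕ) - δ)) #(cliqueTuples G (k + 1)) with hmany | hfew
  · obtain ⟨T, hT, -⟩ := hblowup V G hV hG _ (fun v hv => mem_cliqueTuples.1 hv) hmany
    exact ⟨T, .inl hT⟩
  · subst hV
    obtain ⟨T, hT⟩ := exists_isNClique_mul_of_card_cliqueTuples_le hk hγ hγk hN hGt hdeg <| by
      rw [Real.rpow_natCast] at hNδ
      calc (k + 1) * Fintype.card V * (#(cliqueTuples G (k + 1)) : ℝ)
          ≤ (k + 1) * Fintype.card V * (γ ^ 2 * (1 / (2 * k)) ^ k / (k + 1) *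
              (Fintype.card V : ℝ) ^ (k + 1)) := by
            gcongr
            exact hfew.le.trans hNδ
        _ = (γ * Fintype.card V) ^ 2 * (1 / (2 * k) * Fintype.card V) ^ k := by
            rw [mul_pow (1 / (2 * (k : ℝ)))]
            field_simp
            ring
    exact ⟨T, .inr hT⟩

end MinDegree

section InducedSubgraph

variable {V : Type*} {G : SimpleGraph V}

theorem degreeSumOn_univ [Fintype V] (G : SimpleGraph V) :
    degreeSumOn G univ = 2 * G.edgeSet.ncard := by
  classical
  rw [← SimpleGraph.coe_edgeFinset, Set.ncard_coe_finset, ← G.sum_degrees_eq_twice_card_edges]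
  refine sum_congr rfl fun x _ => ?_
  rw [← G.card_neighborFinset_eq_degree, G.neighborFinset_eq_filter]

theorem degreeSumOn_le_sq (G : SimpleGraph V) (A : Finset V) : degreeSumOn G A ≤ #A ^ 2 := by
  classical
  rw [degreeSumOn, sq, ← smul_eq_mul]
  exact sum_le_card_nsmul _ _ _ fun x _ => card_filter_le _ _

open Classical in
theorem degreeSumOn_erase_add {A : Finset V} {x : V} (hx : x ∈ A) :
    degreeSumOn G (A.erase x) + 2 * #{y ∈ A | G.Adj x y} = degreeSumOn G A := by
  have hdeg : #{y ∈ A | G.Adj x y} = ∑ y ∈ A.erase x, if G.Adj y x then 1 else 0 := by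
    rw [card_filter, ← add_sum_erase _ _ hx]
    simp only [SimpleGraph.irrefl, if_false, zero_add, G.adj_comm]
  have hother (y : V) : #{z ∈ A | G.Adj y z} =
      (if G.Adj y x then 1 else 0) + #{z ∈ A.erase x | G.Adj y z} := by
    rw [card_filter, card_filter, ← add_sum_erase _ _ hx]
  rw [degreeSumOn, degreeSumOn, ← add_sum_erase A _ hx, sum_congr rfl fun y _ => hother y,
    sum_add_distrib, ← hdeg]
  ring

open Classical in
theorem exists_forall_le_card_filter_adj [Fintype V] (G : SimpleGraph V) {a η : ℝ} (ha : 0 ≤ a)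
    (ha1 : a ≤ 1) (hG : (a + η) * (Fintype.card V : ℝ) ^ 2 ≤ 2 * G.edgeSet.ncard) :
    ∃ W : Finset V, η * (Fintype.card V : ℝ) ^ 2 ≤ (#W : ℝ) ^ 2 ∧
      ∀ x ∈ W, a * #W - 1 / 2 ≤ (#{y ∈ W | G.Adj x y} : ℝ) := by
  obtain ⟨W, -, hW⟩ := exists_max_image univ
    (fun W : Finset V => (degreeSumOn G W : ℝ) - a * (#W : ℝ) ^ 2) ⟨∅, mem_univ _⟩
  refine ⟨W, ?_, fun x hx => ?_⟩
  · have huniv := hW univ (mem_univ _)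
    have hdense : (degreeSumOn G W : ℝ) ≤ (#W : ℝ) ^ 2 := by exact_mod_cast degreeSumOn_le_sq G W
    have hnonneg : 0 ≤ a * (#W : ℝ) ^ 2 := by positivity
    rw [degreeSumOn_univ, card_univ] at huniv
    push_cast at huniv
    linarith
  · have herase := hW (W.erase x) (mem_univ _)
    rw [cast_card_erase_of_mem hx, ← degreeSumOn_erase_add hx] at herase
    push_cast at herase
    linarith

open Classical in
theorem degree_induce_coe (G : SimpleGraph V) (W : Finset V) (x : (W : Set V)) :
    (G.induce W).degree x = #{y ∈ W | G.Adj x y} := by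
  rw [← SimpleGraph.card_neighborFinset_eq_degree,
    ← card_map (Function.Embedding.subtype (· ∈ (W : Set V)))]
  congr 1
  ext y
  simp [and_comm]

open Classical in
theorem exists_le_minDegree_induce [Fintype V] (G : SimpleGraph V) {a η : ℝ} (ha : 0 ≤ a)
    (ha1 : a ≤ 1) (hη : 0 < η) (hV : 1 / 2 ≤ η * (√η * Fintype.card V))
    (hG : (a + η) * (Fintype.card V : ℝ) ^ 2 ≤ 2 * G.edgeSet.ncard) :
    ∃ W : Finset V, √η * Fintype.card V ≤ #W ∧
      (a - η) * #W ≤ (G.induce (W : Set V)).minDegree := by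
  obtain ⟨W, hW, hdeg⟩ := exists_forall_le_card_filter_adj G ha ha1 hG
  have hcard : √η * Fintype.card V ≤ #W := by
    refine le_of_pow_le_pow_left₀ two_ne_zero (Nat.cast_nonneg _) ?_
    rwa [mul_pow, Real.sq_sqrt hη.le]
  have hhalf : 1 / 2 ≤ η * #W := hV.trans (by gcongr)
  obtain ⟨x, hx⟩ : W.Nonempty := by
    rw [nonempty_iff_ne_empty]
    rintro rfl
    norm_num at hhalf
  have : Nonempty (W : Set V) := ⟨⟨x, hx⟩⟩
  obtain ⟨y, hy⟩ := (G.induce (W : Set V)).exists_minimal_degree_vertex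
  refine ⟨W, hcard, ?_⟩
  rw [hy, degree_induce_coe]
  linarith [hdeg y y.2]

end InducedSubgraph

section RamseyTuranBounds

theorem eventually_forall_of_mul_le {P : ℕ → Prop} (hP : ∀ᶠ N in atTop, P N) {κ : ℝ}
    (hκ : 0 < κ) : ∀ᶠ n : ℕ in atTop, ∀ N : ℕ, κ * n ≤ N → P N := by
  obtain ⟨N₀, hN₀⟩ := eventually_atTop.1 hP
  have hlim : Tendsto (fun n : ℕ => κ * (n : ℝ)) atTop atTop :=
    tendsto_natCast_atTop_atTop.const_mul_atTop hκ
  filter_upwards [hlim.eventually_ge_atTop (N₀ : ℝ)] with n hn N hN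
  exact hN₀ N (by exact_mod_cast hn.trans hN)

theorem eventually_forall_rpow_le_of_mul_le {ε κ : ℝ} (hε : 0 < ε) (hε1 : ε ≤ 1) (hκ : 0 < κ) :
    ∀ᶠ n : ℕ in atTop, ∀ N : ℕ, κ * n ≤ N → (n : ℝ) ^ (1 - ε) ≤ (N : ℝ) ^ (1 - ε / 2) := by
  filter_upwards [eventually_rpow_sub_le_mul_rpow (c := κ ^ (1 - ε / 2)) (by positivity)
    (half_pos hε) (1 - ε / 2)] with n hn N hN
  calc (n : ℝ) ^ (1 - ε) = (n : ℝ) ^ (1 - ε / 2 - ε / 2) := by ring_nf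
    _ ≤ κ ^ (1 - ε / 2) * (n : ℝ) ^ (1 - ε / 2) := hn
    _ = (κ * n) ^ (1 - ε / 2) := (Real.mul_rpow hκ.le n.cast_nonneg).symm
    _ ≤ (N : ℝ) ^ (1 - ε / 2) := Real.rpow_le_rpow (by positivity) hN (by linarith)

theorem not_cliqueFree_of_isNClique_induce {V : Type*} {G : SimpleGraph V} {W : Set V} {m : ℕ}
    {T : Finset W} (hT : (G.induce W).IsNClique m T) : ¬ G.CliqueFree m :=
  fun hG => hG _ ((SimpleGraph.isNClique_induce_iff W T m).1 hT)

theorem eventually_two_mul_ncard_edgeSet_lt {ε c : ℝ} (hε : 0 < ε) (hε1 : ε ≤ 1) (hc : 0 < c)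
    {r k : ℕ} (hr : 0 < r) (hk : 0 < k) :
    ∀ᶠ n : ℕ in atTop, ∀ (V : Type*) [Fintype V] (G : SimpleGraph V), Fintype.card V = n →
      LargeSetsContainClique G r ((n : ℝ) ^ (1 - ε)) → G.CliqueFree ((k + 1) * r) →
      2 * (G.edgeSet.ncard : ℝ) < (1 - 1 / k + c) * (n : ℝ) ^ 2 := by
  have : 0 < 1 / (k : ℝ) := by positivity
  have hinv1 : 1 / (k : ℝ) ≤ 1 := div_le_one_of_le₀ (by exact_mod_cast hk) (by positivity)
  obtain ⟨η, hη, hηk, hηc⟩ : ∃ η : ℝ, 0 < η ∧ 2 * η ≤ 1 / k ∧ 3 * η ≤ c :=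
    ⟨min (1 / k / 2) (c / 3), by positivity,
      by linarith [min_le_left (1 / (k : ℝ) / 2) (c / 3)],
      by linarith [min_le_right (1 / (k : ℝ) / 2) (c / 3)]⟩
  have hκ : 0 < √η := Real.sqrt_pos.2 hη
  have hlim : Tendsto (fun n : ℕ => η * (√η * (n : ℝ))) atTop atTop :=
    (tendsto_natCast_atTop_atTop.const_mul_atTop hκ).const_mul_atTop hη
  filter_upwards [hlim.eventually_ge_atTop (1 / 2),
    eventually_forall_rpow_le_of_mul_le hε hε1 hκ, eventually_forall_of_mul_le
      (eventually_exists_isNClique_mul_of_le_minDegree (half_pos hε) (by linarith) hη hr hk) hκ]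
    with n hn hpow hclique V _ G hV hG hfree
  subst hV
  by_contra! hedges
  obtain ⟨W, hW, hdeg⟩ := exists_le_minDegree_induce G (a := 1 - 1 / k + 2 * η) (by linarith)
    (by linarith) hη hn
    (hedges.trans' (mul_le_mul_of_nonneg_right (by linarith) (by positivity)))
  rw [show 1 - 1 / (k : ℝ) + 2 * η - η = 1 - 1 / k + η by ring] at hdeg
  obtain ⟨T, hT⟩ := hclique #W hW _ (G.induce (W : Set V)) (by simp)
    ((hG.mono (hpow _ hW)).induce _) (by convert hdeg)
  exact not_cliqueFree_of_isNClique_induce hT hfree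

theorem exists_eventually_two_mul_ncard_edgeSet_lt {ε : ℝ} (hε : 0 < ε) (hε1 : ε ≤ 1) {r k : ℕ}
    (hr : 0 < r) (hk : 2 ≤ k) (t : ℕ) :
    ∃ c : ℝ, 0 < c ∧ ∃ L : ℝ, 0 < L ∧ ∀ᶠ n : ℕ in atTop,
      ∀ (V : Type*) [Fintype V] (G : SimpleGraph V), Fintype.card V = n →
        LargeSetsContainClique G r ((n : ℝ) ^ (1 - ε)) → LargeSetsContainClique G t (L * n) →
        G.CliqueFree ((k + 1) * r) → G.CliqueFree (k * t) →
        2 * (G.edgeSet.ncard : ℝ) < (1 - 1 / k - c) * (n : ℝ) ^ 2 := by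
  classical
  have : (0 : ℝ) < k := by positivity
  have hinv0 : 0 < 1 / (k : ℝ) := by positivity
  have hinv : 1 / (k : ℝ) ≤ 1 / 2 :=
    one_div_le_one_div_of_le (by norm_num) (by exact_mod_cast hk)
  obtain ⟨γ₀, hγ₀pos, hclique₀⟩ := exists_eventually_exists_isNClique_mul_of_le_minDegree
    (half_pos hε) (by linarith) hr (by omega : 0 < k) t
  obtain ⟨γ, hγ, hγ₀, hγ1⟩ : ∃ γ : ℝ, 0 < γ ∧ γ ≤ γ₀ ∧ γ ≤ 1 / 2 :=
    ⟨min γ₀ (1 / 2), by positivity, min_le_left _ _, min_le_right _ _⟩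
  have hκ : 0 < √(γ / 4) := by positivity
  have hlim : Tendsto (fun n : ℕ => γ / 4 * (√(γ / 4) * (n : ℝ))) atTop atTop :=
    (tendsto_natCast_atTop_atTop.const_mul_atTop hκ).const_mul_atTop (by positivity)
  refine ⟨γ / 2, by positivity, 1 / (2 * k) * √(γ / 4), by positivity, ?_⟩
  filter_upwards [hlim.eventually_ge_atTop (1 / 2),
    eventually_forall_rpow_le_of_mul_le hε hε1 hκ, eventually_forall_of_mul_le hclique₀ hκ]
    with n hn hpow hclique V _ G hV hG hGt hfree hfree'
  subst hV
  by_contra! hedges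
  obtain ⟨W, hW, hdeg⟩ := exists_le_minDegree_induce G (a := 1 - 1 / k - 3 * γ / 4) (by linarith)
    (by linarith) (by positivity) hn
    (hedges.trans' (mul_le_mul_of_nonneg_right (by linarith) (by positivity)))
  have hlinear : 1 / (2 * k) * √(γ / 4) * Fintype.card V ≤ 1 / (2 * (k : ℝ)) * #W := by
    rw [mul_assoc]
    gcongr
  have hdegree : (1 - (1 / k + γ₀)) * (#W : ℝ) ≤ (G.induce (W : Set V)).minDegree :=
    hdeg.trans' (mul_le_mul_of_nonneg_right (by linarith) (Nat.cast_nonneg _))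
  obtain ⟨T, hT | hT⟩ := hclique #W hW _ (G.induce (W : Set V)) (by simp)
    ((hG.mono (hpow _ hW)).induce _) ((hGt.mono hlinear).induce _)
    (by convert hdegree)
  · exact not_cliqueFree_of_isNClique_induce hT hfree
  · exact not_cliqueFree_of_isNClique_induce hT hfree'

end RamseyTuranBounds

section GapConjecture

theorem exists_eventually_ramseyNumber_Q_le_rpow {t : ℕ} (ht : 2 ≤ t)
    (hgap : RamseyGapConjecture t) :
    ∃ ε : ℝ, 0 < ε ∧ ε ≤ 1 ∧ ∀ᶠ n : ℕ in atTop,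
      (ramseyNumber (t - 1) (Q t n) : ℝ) ≤ (n : ℝ) ^ (1 - ε) := by
  obtain ⟨ϑ, hϑ, N, -, hgap⟩ := hgap
  have : (0 : ℝ) < t := by positivity
  set ε := min (ϑ / (2 * t)) 1
  refine ⟨ε, by positivity, min_le_right _ _, ?_⟩
  filter_upwards [(tendsto_Q ht).eventually_gt_atTop N, (tendsto_Q ht).eventually_ge_atTop 2,
    eventually_ge_atTop 1] with n hQN hQ2 hn
  have hn1 : (1 : ℝ) ≤ n := by exact_mod_cast hn
  have hQpow : n ≤ Q t n ^ (2 * t) := by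
    rw [pow_mul]
    exact (lt_Q_succ_pow ht n).le.trans (Nat.pow_le_pow_left (by nlinarith) _)
  have hpow : (n : ℝ) ^ ε ≤ (Q t n : ℝ) ^ ϑ := by
    calc (n : ℝ) ^ ε ≤ (n : ℝ) ^ (ϑ / (2 * t)) :=
          Real.rpow_le_rpow_of_exponent_le hn1 (min_le_left _ _)
      _ ≤ ((Q t n : ℝ) ^ (2 * t)) ^ (ϑ / (2 * t)) := by
          gcongr
          exact_mod_cast hQpow
      _ = (Q t n : ℝ) ^ ϑ := by
          rw [← Real.rpow_natCast_mul (Nat.cast_nonneg _)]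
          push_cast
          field_simp
  calc (ramseyNumber (t - 1) (Q t n) : ℝ) ≤ ramseyNumber t (Q t n) / (Q t n : ℝ) ^ ϑ :=
        hgap _ hQN
    _ ≤ n / (n : ℝ) ^ ε := by
        gcongr
        exact ramseyNumber_Q_le t n
    _ = (n : ℝ) ^ (1 - ε) := by rw [Real.rpow_sub (by positivity), Real.rpow_one]

theorem eventually_Q_div_succ_lt {t k : ℕ} (ht : 2 ≤ t) (hk : 2 ≤ k)
    (hgap : RamseyGapConjecture t) : ∀ᶠ n : ℕ in atTop, Q t (n / k + 1) < Q t n := by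
  obtain ⟨ϑ, hϑ, N, -, hgap⟩ := hgap
  have hlarge : ∀ᶠ m : ℕ in atTop, (4 : ℝ) ≤ (m : ℝ) ^ ϑ :=
    ((tendsto_rpow_atTop hϑ).comp tendsto_natCast_atTop_atTop).eventually_ge_atTop 4
  have hQ : Tendsto (fun n => Q t n + 1) atTop atTop :=
    tendsto_atTop_mono (fun n => Nat.le_succ _) (tendsto_Q ht)
  filter_upwards [hQ.eventually_gt_atTop N, hQ.eventually hlarge, eventually_ge_atTop 4] with
    n hQN hQϑ hn
  have hdiv : n / k ≤ n / 2 := Nat.div_le_div_left hk (by norm_num)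
  by_contra! hle
  have heq : Q t n = Q t (n / k + 1) := le_antisymm hle (Q_mono ht (by omega))
  have hsmall : ramseyNumber t (Q t n) ≤ n / k + 1 := heq ▸ ramseyNumber_Q_le t (n / k + 1)
  have hbig := lt_ramseyNumber_Q_succ ht n
  have hrec := ramseyNumber_succ_le (t := t - 1) (by omega) (Q t n)
  rw [Nat.sub_add_cancel (by omega : 1 ≤ t)] at hrec
  have hquarter : 4 * ramseyNumber (t - 1) (Q t n + 1) ≤ ramseyNumber t (Q t n + 1) := by
    rify
    calc (4 : ℝ) * ramseyNumber (t - 1) (Q t n + 1)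
        ≤ 4 * (ramseyNumber t (Q t n + 1) / ((Q t n + 1 : ℕ) : ℝ) ^ ϑ) := by
          gcongr
          exact hgap _ hQN
      _ ≤ 4 * (ramseyNumber t (Q t n + 1) / 4) := by gcongr
      _ = ramseyNumber t (Q t n + 1) := by ring
  omega

theorem exists_eventually_largeSetsContainClique_rpow {t : ℕ} (ht : 2 ≤ t)
    (hgap : RamseyGapConjecture t) :
    ∃ ε : ℝ, 0 < ε ∧ ε ≤ 1 ∧ ∀ᶠ n : ℕ in atTop, ∀ (V : Type*) [Finite V] (G : SimpleGraph V),
      G.indepNum < Q t n → LargeSetsContainClique G (t - 1) ((n : ℝ) ^ (1 - ε)) := by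
  obtain ⟨ε, hε, hε1, hramsey⟩ := exists_eventually_ramseyNumber_Q_le_rpow ht hgap
  refine ⟨ε, hε, hε1, ?_⟩
  filter_upwards [hramsey] with n hn V _ G hG
  exact largeSetsContainClique_iff.2 fun U hU =>
    not_cliqueFreeOn_of_indepNum_lt hG (by exact_mod_cast hn.trans hU)

theorem Q_le_mul_indepNum {V : Type*} [Finite V] {G : SimpleGraph V} {t n q : ℕ} (ht : 2 ≤ t)
    {U : Finset V} (hU : G.CliqueFreeOn U t) (hn : n ≤ q * #U) : Q t n ≤ q * G.indepNum := by
  have hQU : Q t #U ≤ (G.induce (U : Set V)).indepNum :=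
    Q_le_indepNum ((SimpleGraph.cliqueFree_induce_iff _ _ _).2 hU) (by simp)
  calc Q t n ≤ Q t (q * #U) := Q_mono ht hn
    _ ≤ q * Q t #U := Q_mul_le ht q _
    _ ≤ q * G.indepNum := by
        gcongr
        exact hQU.trans (indepNum_comap_le G _)

theorem eventually_largeSetsContainClique_mul {t : ℕ} (ht : 2 ≤ t) {φ : ℕ → ℝ}
    (hφ : Tendsto φ atTop (𝓝 0)) {L : ℝ} (hL : 0 < L) :
    ∀ᶠ n : ℕ in atTop, ∀ (V : Type*) [Finite V] (G : SimpleGraph V),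
      G.indepNum < φ n * Q t n → LargeSetsContainClique G t (L * n) := by
  obtain ⟨q, hq⟩ := exists_nat_ge (1 / L)
  have hq0 : (0 : ℝ) < q := hq.trans_lt' (by positivity)
  filter_upwards [hφ.eventually_le_const (show (0 : ℝ) < 1 / q by positivity)] with n hn V _ G hG
  refine largeSetsContainClique_iff.2 fun U hU hfree => hG.not_ge ?_
  have hnU : (n : ℝ) ≤ q * #U := by
    rw [div_le_iff₀ hL] at hq
    calc (n : ℝ) = 1 * n := (one_mul _).symm
      _ ≤ q * L * n := by gcongr
      _ = q * (L * n) := by ring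
      _ ≤ q * #U := by gcongr
  have hQ : (Q t n : ℝ) ≤ q * G.indepNum := by
    exact_mod_cast Q_le_mul_indepNum ht hfree (by exact_mod_cast hnU)
  calc φ n * Q t n ≤ 1 / q * (q * G.indepNum) := by gcongr
    _ = G.indepNum := by field_simp

end GapConjecture

section JoinCopies

variable {ι V W : Type*}

/-- The join of copies of `F` indexed by `ι`: vertices in different copies are adjacent. -/
def joinCopies (ι : Type*) (F : SimpleGraph W) : SimpleGraph (ι × W) :=
  (⊤ : SimpleGraph ι).comap Prod.fst ⊔ F.comap Prod.snd

theorem joinCopies_adj {F : SimpleGraph W} {x y : ι × W} :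
    (joinCopies ι F).Adj x y ↔ x.1 ≠ y.1 ∨ F.Adj x.2 y.2 :=
  Iff.rfl

theorem cliqueFree_joinCopies [Fintype ι] {F : SimpleGraph W} {t s : ℕ} (hF : F.CliqueFree t)
    (hs : Fintype.card ι * (t - 1) < s) : (joinCopies ι F).CliqueFree s := by
  classical
  intro C hC
  obtain ⟨i, -, hi⟩ := exists_lt_card_fiber_of_mul_lt_card_of_maps_to (s := C) (f := Prod.fst)
    (fun _ _ => mem_univ _) (by rwa [card_univ, hC.card_eq])
  set D := {x ∈ C | x.1 = i} with hD
  have hadj : ∀ x ∈ D, ∀ y ∈ D, x ≠ y → F.Adj x.2 y.2 := by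
    intro x hx y hy hxy
    rw [hD, mem_filter] at hx hy
    exact (joinCopies_adj.1 (hC.isClique hx.1 hy.1 hxy)).resolve_left
      (not_not.2 (hx.2.trans hy.2.symm))
  have hinj : Set.InjOn Prod.snd (D : Set (ι × W)) := fun x hx y hy hxy =>
    by_contra fun hne => (hadj x hx y hy hne).ne hxy
  refine hF.mono (by omega : t ≤ #D) (D.image Prod.snd) ⟨?_, card_image_of_injOn hinj⟩
  rw [coe_image]
  rintro _ ⟨x, hx, rfl⟩ _ ⟨y, hy, rfl⟩ hxy
  exact hadj x hx y hy (ne_of_apply_ne _ hxy)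

open Classical in
theorem indepNum_joinCopies_le [Finite ι] [Finite W] (F : SimpleGraph W) :
    (joinCopies ι F).indepNum ≤ F.indepNum := by
  obtain ⟨I, hI⟩ := (joinCopies ι F).exists_isNIndepSet_indepNum
  have hnonadj : ∀ x ∈ I, ∀ y ∈ I, x ≠ y → x.1 = y.1 ∧ ¬ F.Adj x.2 y.2 := by
    intro x hx y hy hxy
    simpa [joinCopies_adj] using hI.isIndepSet hx hy hxy
  have hinj : Set.InjOn Prod.snd (I : Set (ι × W)) := fun x hx y hy hxy =>
    by_contra fun hne => hne (Prod.ext (hnonadj x hx y hy hne).1 hxy)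
  rw [← hI.card_eq, ← card_image_of_injOn hinj]
  refine SimpleGraph.IsIndepSet.card_le_indepNum ?_
  rw [coe_image]
  rintro _ ⟨x, hx, rfl⟩ _ ⟨y, hy, rfl⟩ hxy
  exact (hnonadj x hx y hy (ne_of_apply_ne _ hxy)).2

open Classical in
theorem card_filter_not_adj_comap_joinCopies_le [Fintype V] [Fintype W] (F : SimpleGraph W)
    (e : V ↪ ι × W) (x : V) :
    #{y | ¬ ((joinCopies ι F).comap e).Adj x y} ≤ Fintype.card W := by
  rw [← card_univ (α := W)]
  refine card_le_card_of_injOn (fun y => (e y).2) (fun _ _ => mem_coe.2 (mem_univ _)) ?_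
  have hsame : ∀ y, ¬ ((joinCopies ι F).comap e).Adj x y → (e x).1 = (e y).1 := fun y hy => by
    simp only [SimpleGraph.comap_adj, joinCopies_adj, not_or, not_not] at hy
    exact hy.1
  simp only [coe_filter, mem_univ, true_and]
  exact fun y hy z hz hyz => e.injective (Prod.ext ((hsame y hy).symm.trans (hsame z hz)) hyz)

open Classical in
theorem mul_sub_le_two_mul_ncard_edgeSet [Fintype V] {G : SimpleGraph V} {D : ℝ}
    (hG : ∀ x, (#{y | ¬ G.Adj x y} : ℝ) ≤ D) :
    (Fintype.card V : ℝ) * (Fintype.card V - D) ≤ 2 * G.edgeSet.ncard := by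
  have hdeg (x : V) : (Fintype.card V : ℝ) - D ≤ G.degree x := by
    have hsum : (#{y | ¬ G.Adj x y} : ℝ) + G.degree x = Fintype.card V := by
      exact_mod_cast card_filter_not_adj_add_degree G x
    linarith [hG x]
  have hsum := card_nsmul_le_sum univ (fun x => (G.degree x : ℝ)) _ fun x _ => hdeg x
  rw [card_univ, nsmul_eq_mul] at hsum
  refine hsum.trans_eq ?_
  rw [← SimpleGraph.coe_edgeFinset, Set.ncard_coe_finset]
  exact_mod_cast G.sum_degrees_eq_twice_card_edges

theorem eventually_exists_le_two_mul_ncard_edgeSet {t k s : ℕ} (ht : 2 ≤ t) (hk : 2 ≤ k)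
    (hgap : RamseyGapConjecture t) (hs : k * (t - 1) < s) {c : ℝ} (hc : 0 < c) :
    ∀ᶠ n : ℕ in atTop, ∃ G : SimpleGraph (Fin n), G.CliqueFree s ∧ G.indepNum < Q t n ∧
      (1 - 1 / k - c) * (n : ℝ) ^ 2 ≤ 2 * (G.edgeSet.ncard : ℝ) := by
  classical
  have hlim : Tendsto (fun n : ℕ => c * (n : ℝ)) atTop atTop :=
    tendsto_natCast_atTop_atTop.const_mul_atTop hc
  filter_upwards [eventually_Q_div_succ_lt ht hk hgap, hlim.eventually_ge_atTop 1] with n hQ hn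
  obtain ⟨F, hF, hFQ⟩ := exists_indepNum_eq_Q ht (n / k + 1)
  obtain ⟨e⟩ : Nonempty (Fin n ↪ Fin k × Fin (n / k + 1)) :=
    Function.Embedding.nonempty_of_card_le
      (by simpa using (Nat.lt_mul_div_succ n (by omega : 0 < k)).le)
  refine ⟨(joinCopies (Fin k) F).comap e, ?_, ?_, ?_⟩
  · exact (cliqueFree_joinCopies hF (by rwa [Fintype.card_fin])).comap
      (SimpleGraph.Embedding.comap e _).isContained
  · exact ((indepNum_comap_le _ e).trans (indepNum_joinCopies_le F)).trans_lt (hFQ ▸ hQ)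
  · have hD (x : Fin n) :
        (#{y | ¬ ((joinCopies (Fin k) F).comap e).Adj x y} : ℝ) ≤ n / k + c * n := by
      calc (#{y | ¬ ((joinCopies (Fin k) F).comap e).Adj x y} : ℝ) ≤ (n / k + 1 : ℕ) := by
            exact_mod_cast (Fintype.card_fin (n / k + 1)) ▸
              card_filter_not_adj_comap_joinCopies_le F e x
        _ = (n / k : ℕ) + 1 := Nat.cast_succ _
        _ ≤ n / k + c * n := add_le_add Nat.cast_div_le hn
    refine le_of_eq_of_le ?_ (mul_sub_le_two_mul_ncard_edgeSet hD)
    rw [Fintype.card_fin]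
    ring

end JoinCopies

section Densities

variable {U : Type*} (H : SimpleGraph U) (f : ℕ → ℝ)

theorem two_mul_ncard_edgeSet_le_sq {V : Type*} [Fintype V] (G : SimpleGraph V) :
    2 * G.edgeSet.ncard ≤ Fintype.card V ^ 2 := by
  classical
  rw [← degreeSumOn_univ, ← card_univ]
  exact degreeSumOn_le_sq G univ

theorem bddAbove_ncard_edgeSet (n : ℕ) (x : ℝ) :
    BddAbove {e : ℕ | ∃ G : SimpleGraph (Fin n),
      H.Free G ∧ (G.indepNum : ℝ) < x ∧ G.edgeSet.ncard = e} := by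
  refine ⟨n ^ 2, ?_⟩
  rintro e ⟨G, -, -, rfl⟩
  have hG := two_mul_ncard_edgeSet_le_sq G
  rw [Fintype.card_fin] at hG
  omega

variable {H}

theorem ncard_edgeSet_le_RT {n : ℕ} {x : ℝ} {G : SimpleGraph (Fin n)} (hG : H.Free G)
    (hx : (G.indepNum : ℝ) < x) : G.edgeSet.ncard ≤ RT n H x :=
  le_csSup (bddAbove_ncard_edgeSet H n x) ⟨G, hG, hx, rfl⟩

theorem two_mul_RT_le {n : ℕ} {x b : ℝ} (hb : 0 ≤ b)
    (h : ∀ G : SimpleGraph (Fin n), H.Free G → (G.indepNum : ℝ) < x →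
      2 * (G.edgeSet.ncard : ℝ) ≤ b) : 2 * (RT n H x : ℝ) ≤ b := by
  rcases Set.eq_empty_or_nonempty {e : ℕ | ∃ G : SimpleGraph (Fin n),
    H.Free G ∧ (G.indepNum : ℝ) < x ∧ G.edgeSet.ncard = e} with hempty | hne
  · rw [RT, hempty]
    simpa using hb
  · obtain ⟨G, hG, hx, hedges⟩ := Nat.sSup_mem hne (bddAbove_ncard_edgeSet H n x)
    rw [RT, ← hedges]
    exact h G hG hx

variable (H)

theorem RT_div_sq_le_one (n : ℕ) (x : ℝ) : (RT n H x : ℝ) / (n : ℝ) ^ 2 ≤ 1 := by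
  have hRT := two_mul_RT_le (H := H) (n := n) (x := x) (b := (n : ℝ) ^ 2) (by positivity)
    fun G _ _ => by exact_mod_cast Fintype.card_fin n ▸ two_mul_ncard_edgeSet_le_sq G
  refine div_le_one_of_le₀ ?_ (by positivity)
  linarith [Nat.cast_nonneg (α := ℝ) (RT n H x)]

theorem isBoundedUnder_le_RT_div_sq :
    IsBoundedUnder (· ≤ ·) atTop (fun n : ℕ => (RT n H (f n) : ℝ) / (n : ℝ) ^ 2) :=
  isBoundedUnder_of ⟨1, fun n => RT_div_sq_le_one H n (f n)⟩

theorem isBoundedUnder_ge_RT_div_sq :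
    IsBoundedUnder (· ≥ ·) atTop (fun n : ℕ => (RT n H (f n) : ℝ) / (n : ℝ) ^ 2) :=
  isBoundedUnder_of ⟨0, fun n => by positivity⟩

theorem lowerDensity_le_upperDensity : lowerDensity H f ≤ upperDensity H f :=
  liminf_le_limsup (isBoundedUnder_le_RT_div_sq H f) (isBoundedUnder_ge_RT_div_sq H f)

theorem lowerDensity_nonneg : 0 ≤ lowerDensity H f :=
  le_liminf_of_le (isBoundedUnder_le_RT_div_sq H f).isCoboundedUnder_ge
    (Eventually.of_forall fun n => by positivity)

variable {H f}

theorem upperDensity_le {a : ℝ} (ha : 0 ≤ a)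
    (h : ∀ᶠ n : ℕ in atTop, ∀ G : SimpleGraph (Fin n), H.Free G →
      (G.indepNum : ℝ) < f n → 2 * (G.edgeSet.ncard : ℝ) ≤ a * (n : ℝ) ^ 2) :
    upperDensity H f ≤ a / 2 := by
  refine limsup_le_of_le (isBoundedUnder_ge_RT_div_sq H f).isCoboundedUnder_le ?_
  filter_upwards [h] with n hn
  refine div_le_of_le_mul₀ (by positivity) (by positivity) ?_
  linarith [two_mul_RT_le (by positivity) hn]

theorem le_lowerDensity {a : ℝ}
    (h : ∀ᶠ n : ℕ in atTop, ∃ G : SimpleGraph (Fin n), H.Free G ∧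
      (G.indepNum : ℝ) < f n ∧ a * (n : ℝ) ^ 2 ≤ 2 * (G.edgeSet.ncard : ℝ)) :
    a / 2 ≤ lowerDensity H f := by
  refine le_liminf_of_le (isBoundedUnder_le_RT_div_sq H f).isCoboundedUnder_ge ?_
  filter_upwards [h, eventually_gt_atTop 0] with n ⟨G, hG, hx, hedges⟩ hn
  have hRT : (G.edgeSet.ncard : ℝ) ≤ RT n H (f n) := by
    exact_mod_cast ncard_edgeSet_le_RT hG hx
  rw [le_div_iff₀ (by positivity)]
  linarith

end Densities

section PhaseTransition

theorem completeGraph_free_iff {V : Type*} {G : SimpleGraph V} {s : ℕ} :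
    (SimpleGraph.completeGraph (Fin s)).Free G ↔ G.CliqueFree s := by
  have hfree := SimpleGraph.cliqueFree_iff_top_free (G := G) (β := Fin s)
  rw [Fintype.card_fin] at hfree
  exact hfree.symm

variable {s t k : ℕ}

theorem upperDensity_Q_le (ht : 2 ≤ t) (hk : 0 < k) (hgap : RamseyGapConjecture t)
    (hs : s ≤ (k + 1) * (t - 1)) :
    upperDensity (SimpleGraph.completeGraph (Fin s)) (fun n => (Q t n : ℝ)) ≤
      (1 - 1 / k) / 2 := by
  obtain ⟨ε, hε, hε1, hsets⟩ := exists_eventually_largeSetsContainClique_rpow ht hgap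
  have hk1 : 1 / (k : ℝ) ≤ 1 :=
    div_le_one_of_le₀ (by exact_mod_cast hk) (Nat.cast_nonneg _)
  refine le_of_forall_pos_le_add fun c hc => ?_
  refine (upperDensity_le (a := 1 - 1 / k + 2 * c) (by linarith) ?_).trans (by linarith)
  filter_upwards [hsets, eventually_two_mul_ncard_edgeSet_lt hε hε1
    (show 0 < 2 * c by positivity) (show 0 < t - 1 by omega) hk] with n hn hbound G hG hα
  exact (hbound _ G (Fintype.card_fin n) (hn _ G (by exact_mod_cast hα))
    ((completeGraph_free_iff.1 hG).mono hs)).le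

theorem upperDensity_mul_Q_lt (ht : 2 ≤ t) (hk : 2 ≤ k) (hgap : RamseyGapConjecture t)
    (hs : s ≤ (k + 1) * (t - 1)) (hs' : s ≤ k * t) {φ : ℕ → ℝ} (hφ : Tendsto φ atTop (𝓝 0)) :
    upperDensity (SimpleGraph.completeGraph (Fin s)) (fun n => φ n * (Q t n : ℝ)) <
      (1 - 1 / k) / 2 := by
  obtain ⟨ε, hε, hε1, hsets⟩ := exists_eventually_largeSetsContainClique_rpow ht hgap
  obtain ⟨c, hc, L, hL, hbound⟩ :=
    exists_eventually_two_mul_ncard_edgeSet_lt hε hε1 (show 0 < t - 1 by omega) hk t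
  have hk1 : 1 / (k : ℝ) < 1 := by
    rw [div_lt_one (by positivity)]
    exact_mod_cast hk
  refine (upperDensity_le (a := max 0 (1 - 1 / k - c)) (le_max_left _ _) ?_).trans_lt ?_
  · filter_upwards [hsets, hbound, eventually_largeSetsContainClique_mul ht hφ hL,
      hφ.eventually_le_const one_pos] with n hn hbound hlinear hφ1 G hG hα
    have hfree := completeGraph_free_iff.1 hG
    have hαQ : (G.indepNum : ℝ) < Q t n :=
      hα.trans_le (mul_le_of_le_one_left (Nat.cast_nonneg _) hφ1)
    refine (hbound _ G (Fintype.card_fin n) (hn _ G (by exact_mod_cast hαQ)) (hlinear _ G hα)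
      (hfree.mono hs) (hfree.mono hs')).le.trans ?_
    gcongr
    exact le_max_right _ _
  · gcongr
    exact max_lt (by linarith) (by linarith)

theorem le_lowerDensity_Q (ht : 2 ≤ t) (hk : 2 ≤ k) (hgap : RamseyGapConjecture t)
    (hs : k * (t - 1) < s) :
    (1 - 1 / k) / 2 ≤
      lowerDensity (SimpleGraph.completeGraph (Fin s)) (fun n => (Q t n : ℝ)) := by
  refine le_of_forall_sub_le fun c hc => ?_
  refine le_trans (by linarith) (le_lowerDensity (a := 1 - 1 / k - 2 * c) ?_)
  filter_upwards [eventually_exists_le_two_mul_ncard_edgeSet ht hk hgap hs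
    (show 0 < 2 * c by positivity)] with n ⟨G, hG, hα, hedges⟩
  exact ⟨G, completeGraph_free_iff.2 hG, by exact_mod_cast hα, hedges⟩

theorem exists_two_le_mul_lt_le_succ_mul {m : ℕ} (hm : 0 < m) (hs : 2 * m < s) :
    ∃ k, 2 ≤ k ∧ k * m < s ∧ s ≤ (k + 1) * m := by
  refine ⟨(s - 1) / m, ?_, ?_, ?_⟩
  · rw [Nat.le_div_iff_mul_le hm]
    omega
  · have := Nat.div_mul_le_self (s - 1) m
    omega
  · have := Nat.lt_mul_div_succ (s - 1) hm
    rw [mul_comm] at this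
    omega

end PhaseTransition

end RamseyTuran

theorem mainTheorem10 (s t : ℕ) (ht : 2 ≤ t)
    (hconj : RamseyTuran.RamseyGapConjecture t)
    (hconj' : RamseyTuran.RamseyGapConjecture (t + 1))
    (hpt : RamseyTuran.HasPhaseTransition (SimpleGraph.completeGraph (Fin s))
      (fun n => (RamseyTuran.Q t n : ℝ)) (fun n => (RamseyTuran.Q (t + 1) n : ℝ))) :
    RamseyTuran.HasStrongPhaseTransition (SimpleGraph.completeGraph (Fin s))
      (fun n => (RamseyTuran.Q t n : ℝ)) := by 
  obtain ⟨-, hlt⟩ := hpt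
  have hmono := RamseyTuran.lowerDensity_le_upperDensity (SimpleGraph.completeGraph (Fin s))
  have htwo : 2 * (t - 1) < s := by
    by_contra! hs
    have hupper := RamseyTuran.upperDensity_Q_le ht one_pos hconj hs
    have hlower := RamseyTuran.lowerDensity_nonneg (SimpleGraph.completeGraph (Fin s))
      (fun n => (RamseyTuran.Q (t + 1) n : ℝ))
    norm_num at hupper
    linarith [hmono fun n => (RamseyTuran.Q t n : ℝ),
      hmono fun n => (RamseyTuran.Q (t + 1) n : ℝ)]
  obtain ⟨k, hk, hks, hsk⟩ := RamseyTuran.exists_two_le_mul_lt_le_succ_mul (by omega) htwo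
  have hst : s ≤ k * t := by
    by_contra! hs
    have hupper := RamseyTuran.upperDensity_Q_le ht (by omega) hconj hsk
    have hlower := RamseyTuran.le_lowerDensity_Q (by omega) hk hconj' (by simpa using hs)
    linarith [hmono fun n => (RamseyTuran.Q t n : ℝ),
      hmono fun n => (RamseyTuran.Q (t + 1) n : ℝ)]
  refine fun φ hφ => ⟨?_, (RamseyTuran.upperDensity_mul_Q_lt ht hk hconj hsk hst hφ).trans_le
    (RamseyTuran.le_lowerDensity_Q ht hk hconj hks)⟩
  filter_upwards [hφ.eventually_le_const one_pos] with n hn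
  exact mul_le_of_le_one_left (Nat.cast_nonneg _) hn
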